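/- Let $\Omega\subseteq\mathbb{R}^3$, let $\boldsymbol u=(u,v,w):\Omega\to\mathbb{R}^3$ be a three-channel volume image of class $C^2$, and let $\boldsymbol x_0$ be an interior point of $\Omega$. For $\varrho>0$ let $B_\varrho(\boldsymbol x_0)$ be the ball of radius $\varrho$ about $\boldsymbol x_0$. A value of one step of Oja median filtering of $\boldsymbol u$ at $\boldsymbol x_0$ with structuring element $B_\varrho$ is any global minimiser $\boldsymbol m\in\mathbb{R}^3$ of $$\int_{B_\varrho(\boldsymbol x_0)}\int_{B_\varrho(\boldsymbol x_0)}\int_{B_\varrho(\boldsymbol x_0)}\bigl|[\boldsymbol m,\boldsymbol u(\boldsymbol x_1),\boldsymbol u(\boldsymbol x_2),\boldsymbol u(\boldsymbol x_3)]\bigr|\,\mathrm d\boldsymbol x_3\,\mathrm d\boldsymbol x_2\,\mathrm d\boldsymbol x_1,$$ where $|[\boldsymbol m,\boldsymbol a,\boldsymbol b,\boldsymbol c]|=\tfrac16|\det(\boldsymbol a-\boldsymbol m,\boldsymbol b-\boldsymbol m,\boldsymbol c-\boldsymbol m)|$ is the volume of a tetrahedron. We say that the step approximates for $\varrho\to0$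 an explicit time step of size $\tau(\varrho)$ of a system $\boldsymbol u_t=F$ at $\boldsymbol x_0$ if for all sufficiently small $\varrho>0$ such a value exists, and every such value satisfies $\boldsymbol m=\boldsymbol u(\boldsymbol x_0)+\tau(\varrho)F(\boldsymbol x_0)+o(\tau(\varrho))$ as $\varrho\to0$, uniformly in the choice of $\boldsymbol m$. (a) If $\boldsymbol D:=\mathrm D\boldsymbol u(\boldsymbol x_0)$ satisfies $\det\boldsymbol D\neq0$, then at $\boldsymbol x_0$ one step of Oja median filtering of $\boldsymbol u$ with structuring element $B_\varrho$ approximates for $\varrho\to0$ an explicit time step of size $\tau=\varrho^2/60$ of the PDE system $$\boldsymbol u_t=5(\boldsymbol u_{xx}+\boldsymbol u_{yy}+\boldsymbol u_{zz})+\boldsymbol A_1(\boldsymbol u_{yy}-\boldsymbol u_{xx})+\boldsymbol A_2(\boldsymbol u_{zz}-\boldsymbol u_{xx})-3\boldsymbol B_1\boldsymbol u_{xy}-3\boldsymbol B_2\boldsymbol u_{xz}-3\boldsymbol B_3\boldsymbol u_{yz},$$ where $$\boldsymbol A_1=\boldsymbol I-3\boldsymbol D\,\mathrm{diag}(0,1,0)\,\boldsymbol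 D^{-1},\qquad \boldsymbol A_2=\boldsymbol I-3\boldsymbol D\,\mathrm{diag}(0,0,1)\,\boldsymbol D^{-1},$$ $$\boldsymbol B_1=\boldsymbol D\begin{pmatrix}0&1&0\\1&0&0\\0&0&0\end{pmatrix}\boldsymbol D^{-1},\quad \boldsymbol B_2=\boldsymbol D\begin{pmatrix}0&0&1\\0&0&0\\1&0&0\end{pmatrix}\boldsymbol D^{-1},\quad \boldsymbol B_3=\boldsymbol D\begin{pmatrix}0&0&0\\0&0&1\\0&1&0\end{pmatrix}\boldsymbol D^{-1}.$$ (b) If $\mathrm D\boldsymbol u(\boldsymbol x_0)=\boldsymbol I$, then at $\boldsymbol x_0$ one step of Oja median filtering of $\boldsymbol u$ with structuring element $B_\varrho$ approximates for $\varrho\to0$ an explicit time step of size $\tau=\varrho^2/20$ of the PDE system $$u_t=u_{xx}+2(u_{yy}+u_{zz})-(v_{xy}+w_{xz}),$$ $$v_t=v_{yy}+2(v_{xx}+v_{zz})-(u_{xy}+w_{yz}),$$ $$w_t=w_{zz}+2(w_{xx}+w_{yy})-(u_{xz}+v_{yz}).$$ -/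

import Mathlib

open MeasureTheory Filter Topology
open scoped Matrix

noncomputable section

namespace OjaMedian

/-- Three-dimensional Euclidean space: both the image domain (coordinates `x, y, z`) and the
space of data values (channels `u, v, w`). -/
abbrev E3 : Type := EuclideanSpace ℝ (Fin 3)

/-- Volume of the tetrahedron with vertices `m, a, b, c`. -/
def tetraVolume (m a b c : E3) : ℝ :=
  |(Matrix.of ![(a - m).ofLp, (b - m).ofLp, (c - m).ofLp]).det| / 6

/-- Total volume of the tetrahedra formed by `m` and three data points, for data values
distributed according to the measure `μ`. -/
def ojaObjective (μ : Measure E3) (m : E3) : ℝ :=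
  ∫ a, ∫ b, ∫ c, tetraVolume m a b c ∂μ ∂μ ∂μ

/-- `m` is an Oja (simplex) median of the distribution `μ`: a global minimiser of the total
tetrahedron volume. Medians need not be unique, so this is a predicate; multiplying `μ` by a
positive constant does not change it. -/
def IsOjaMedian (μ : Measure E3) (m : E3) : Prop :=
  ∀ m' : E3, ojaObjective μ m ≤ ojaObjective μ m'

/-- The distribution of the values of the image `u` selected by the ball of radius `ρ` about `x`:
the push-forward under `u` of the (unnormalised) uniform distribution on that ball. -/
def localValues (u : E3 → E3) (x : E3) (ρ : ℝ) : Measure E3 :=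
  Measure.map u (volume.restrict (Metric.closedBall x ρ))

/-- `m` is a possible result at `x` of one step of Oja median filtering of `u`, with the ball of
radius `ρ` as structuring element. -/
def IsOjaFilterValue (u : E3 → E3) (x : E3) (ρ : ℝ) (m : E3) : Prop :=
  IsOjaMedian (localValues u x ρ) m

/-- At `x`, one step of Oja median filtering of `u` approximates for `ρ → 0` an explicit time step
of size `τ ρ` of a PDE system whose right-hand side, evaluated for `u` at `x`, is `F`: for all
small `ρ > 0` a filter value exists, and every filter value is `u x + τ ρ • F + o(τ ρ)`,
uniformly over the choice of the filter value. -/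
def OjaStepApproximates (u : E3 → E3) (x : E3) (τ : ℝ → ℝ) (F : E3) : Prop :=
  (∀ᶠ ρ : ℝ in 𝓝[>] 0, ∃ m : E3, IsOjaFilterValue u x ρ m) ∧
  ∀ ε : ℝ, 0 < ε → ∀ᶠ ρ : ℝ in 𝓝[>] 0, ∀ m : E3, IsOjaFilterValue u x ρ m →
    ‖m - (u x + τ ρ • F)‖ ≤ ε * τ ρ

/-- The partial derivative `∂_j u`, taken in all three channels; `j = 0, 1, 2` is `x, y, z`. -/
def pderiv (j : Fin 3) (u : E3 → E3) (p : E3) : E3 :=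
  fderiv ℝ u p (EuclideanSpace.single j 1)

/-- The second partial derivative `u_{jk} = ∂_k ∂_j u`, taken in all three channels. -/
def pderiv2 (j k : Fin 3) (u : E3 → E3) (p : E3) : E3 :=
  pderiv k (pderiv j u) p

/-- The Jacobian matrix `Du`: rows are channels, columns are directions of differentiation. -/
def jacobian (u : E3 → E3) (p : E3) : Matrix (Fin 3) (Fin 3) ℝ :=
  Matrix.of fun i j => pderiv j u p i

def A₁ (D : Matrix (Fin 3) (Fin 3) ℝ) : Matrix (Fin 3) (Fin 3) ℝ :=
  1 - (3 : ℝ) • (D * Matrix.diagonal ![0, 1, 0] * D⁻¹)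

def A₂ (D : Matrix (Fin 3) (Fin 3) ℝ) : Matrix (Fin 3) (Fin 3) ℝ :=
  1 - (3 : ℝ) • (D * Matrix.diagonal ![0, 0, 1] * D⁻¹)

def B₁ (D : Matrix (Fin 3) (Fin 3) ℝ) : Matrix (Fin 3) (Fin 3) ℝ :=
  D * !![0, 1, 0; 1, 0, 0; 0, 0, 0] * D⁻¹

def B₂ (D : Matrix (Fin 3) (Fin 3) ℝ) : Matrix (Fin 3) (Fin 3) ℝ :=
  D * !![0, 0, 1; 0, 0, 0; 1, 0, 0] * D⁻¹

def B₃ (D : Matrix (Fin 3) (Fin 3) ℝ) : Matrix (Fin 3) (Fin 3) ℝ :=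
  D * !![0, 0, 0; 0, 0, 1; 0, 1, 0] * D⁻¹

/-- Matrix-vector product on Euclidean space. -/
def act (M : Matrix (Fin 3) (Fin 3) ℝ) (v : E3) : E3 := WithLp.toLp 2 (M *ᵥ v.ofLp)

/-- Right-hand side of the PDE system for a general invertible Jacobian. -/
def ojaRHS (u : E3 → E3) (p : E3) : E3 :=
  (5 : ℝ) • (pderiv2 0 0 u p + pderiv2 1 1 u p + pderiv2 2 2 u p)
    + act (A₁ (jacobian u p)) (pderiv2 1 1 u p - pderiv2 0 0 u p)
    + act (A₂ (jacobian u p)) (pderiv2 2 2 u p - pderiv2 0 0 u p)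
    - (3 : ℝ) • act (B₁ (jacobian u p)) (pderiv2 0 1 u p)
    - (3 : ℝ) • act (B₂ (jacobian u p)) (pderiv2 0 2 u p)
    - (3 : ℝ) • act (B₃ (jacobian u p)) (pderiv2 1 2 u p)

/-- Right-hand side of the PDE system for the case where the Jacobian is the unit matrix. -/
def ojaRHSUnit (u : E3 → E3) (p : E3) : E3 :=
  !₂[pderiv2 0 0 u p 0 + 2 * (pderiv2 1 1 u p 0 + pderiv2 2 2 u p 0)
        - (pderiv2 0 1 u p 1 + pderiv2 0 2 u p 2),
     pderiv2 1 1 u p 1 + 2 * (pderiv2 0 0 u p 1 + pderiv2 2 2 u p 1)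
        - (pderiv2 0 1 u p 0 + pderiv2 1 2 u p 2),
     pderiv2 2 2 u p 2 + 2 * (pderiv2 0 0 u p 2 + pderiv2 1 1 u p 2)
        - (pderiv2 0 2 u p 0 + pderiv2 1 2 u p 1)]

end OjaMedian

end

open MeasureTheory Filter Topology
open scoped Matrix RealInnerProductSpace

noncomputable section

namespace OjaMedian

/-! ### The sign function -/

/-! Write `u (x + ρ y) = u x + ρ D w(y)` on the unit ball. By Taylor expansion `w(y) = y + (ρ/2)
Q(y, y) + o(ρ)`, where `Q` is the second derivative of `u` multiplied by `D⁻¹`. Determinants make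
the objective affinely equivariant (`ojaObjective_localValues`), so filter values are exactly the
points `u x + ρ D n` with `n` minimising `volumeSum w`.

A signed tetrahedron volume is affine in its vertex `n`, hence `volumeSum w` is convex, with the
explicit subgradient inequality `volumeSum_sub_ge`. Integrating out the third point expresses the
slope through `halfSpaceDiff`: how unevenly the plane through `n` and two data points splits the
mass.

At `n = ρ k` this imbalance vanishes to zeroth order. Its first-order part is the normal
displacement integrated over the disc cut from the ball by the central plane, which gives `2 ρ ·
discArea · halfSpaceCoeff` uniformly in the normal (`exists_abs_halfSpaceDiff_sub_le`). Averaging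
over the normals, weighted by parallelogram area, needs only the isotropic second and fourth moments
`integral_dirCross_two` and `integral_dirCross_four`. The descent rate in direction `e` is therefore
a positive multiple of `ρ ⟪medianShift Q - k, e⟫`, up to `o(ρ)` (`exists_abs_descentRate_sub_le`).

Consequently the objective increases outwards across the sphere of radius `ρ δ` about `ρ •
medianShift Q`, for every fixed `δ > 0` and small `ρ`. Convexity then yields existence of minimisers
and confines all of them to that ball, with no need for uniqueness. Finally `D` maps `medianShift Q`
to one sixtieth of the right-hand side (`act_medianShift`); the case of unit Jacobian is a
specialisation. -/

theorem sign_mono : Monotone Real.sign := by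
  intro x y h
  unfold Real.sign
  split_ifs <;> linarith

theorem measurable_sign : Measurable Real.sign := sign_mono.measurable

theorem abs_sign_le (x : ℝ) : |Real.sign x| ≤ 1 := by
  rcases Real.sign_apply_eq x with h | h | h <;> simp [h]

/-- The sign is a subgradient of the absolute value, the value 0 at the kink included. All convexity
used for the objective comes from this inequality. -/
theorem sign_mul_sub_le (s t : ℝ) : Real.sign t * (s - t) ≤ |s| - |t| := by
  rcases lt_trichotomy t 0 with h | h | h
  · rw [Real.sign_of_neg h, abs_of_neg h]; linarith [neg_abs_le s]
  · subst h; simp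
  · rw [Real.sign_of_pos h, abs_of_pos h]; linarith [le_abs_self s]

theorem sign_mul_of_pos {c : ℝ} (hc : 0 < c) (x : ℝ) : Real.sign (c * x) = Real.sign x := by
  rcases lt_trichotomy x 0 with h | h | h
  · rw [Real.sign_of_neg h, Real.sign_of_neg (mul_neg_of_pos_of_neg hc h)]
  · simp [h]
  · rw [Real.sign_of_pos h, Real.sign_of_pos (mul_pos hc h)]

/-! ### The cross product on Euclidean space -/

def cross (a b : E3) : E3 :=
  !₂[a 1 * b 2 - a 2 * b 1, a 2 * b 0 - a 0 * b 2, a 0 * b 1 - a 1 * b 0]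

@[simp] theorem cross_apply_zero (a b : E3) : cross a b 0 = a 1 * b 2 - a 2 * b 1 := rfl
@[simp] theorem cross_apply_one (a b : E3) : cross a b 1 = a 2 * b 0 - a 0 * b 2 := rfl
@[simp] theorem cross_apply_two (a b : E3) : cross a b 2 = a 0 * b 1 - a 1 * b 0 := rfl

theorem inner_eq_coords (x y : E3) : ⟪x, y⟫ = x 0 * y 0 + x 1 * y 1 + x 2 * y 2 := by
  simp [PiLp.inner_apply, Fin.sum_univ_three, mul_comm]

theorem inner_cross_eq_det (a b c : E3) :
    ⟪cross a b, c⟫ = (Matrix.of ![a.ofLp, b.ofLp, c.ofLp]).det := by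
  rw [inner_eq_coords, Matrix.det_fin_three]
  simp
  ring

/-- A Gram determinant: the squared triple product depends on inner products only. Squaring removes
the orientation sign, so invariance holds for reflections as well as rotations. -/
theorem inner_cross_sq (a b c : E3) :
    ⟪cross a b, c⟫ ^ 2 = ⟪a, a⟫ * ⟪b, b⟫ * ⟪c, c⟫ + 2 * ⟪a, b⟫ * ⟪b, c⟫ * ⟪a, c⟫
      - ⟪a, a⟫ * ⟪b, c⟫ ^ 2 - ⟪b, b⟫ * ⟪a, c⟫ ^ 2 - ⟪c, c⟫ * ⟪a, b⟫ ^ 2 := by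
  simp only [inner_eq_coords, cross_apply_zero, cross_apply_one, cross_apply_two]
  ring

theorem norm_cross_sq (a b : E3) :
    ‖cross a b‖ ^ 2 = ⟪a, a⟫ * ⟪b, b⟫ - ⟪a, b⟫ ^ 2 := by
  rw [← real_inner_self_eq_norm_sq]
  simp only [inner_eq_coords, cross_apply_zero, cross_apply_one, cross_apply_two]
  ring

theorem norm_cross_le (a b : E3) : ‖cross a b‖ ≤ ‖a‖ * ‖b‖ := by
  refine abs_le_of_sq_le_sq' ?_ (by positivity) |>.2
  rw [norm_cross_sq, real_inner_self_eq_norm_sq, real_inner_self_eq_norm_sq, mul_pow]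
  nlinarith [sq_nonneg ⟪a, b⟫]

theorem norm_cross_map (R : E3 ≃ₗᵢ[ℝ] E3) (a b : E3) : ‖cross (R a) (R b)‖ = ‖cross a b‖ := by
  rw [← abs_norm, ← abs_norm (cross a b), ← sq_eq_sq_iff_abs_eq_abs, norm_cross_sq, norm_cross_sq]
  simp only [R.inner_map_map]

theorem inner_cross_map_sq (R : E3 ≃ₗᵢ[ℝ] E3) (a b c : E3) :
    ⟪cross (R a) (R b), R c⟫ ^ 2 = ⟪cross a b, c⟫ ^ 2 := by
  rw [inner_cross_sq, inner_cross_sq]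
  simp only [R.inner_map_map]

theorem cross_sub_cross (a b a' b' : E3) :
    cross a' b' - cross a b = cross (a' - a) b' + cross a (b' - b) := by
  ext i
  fin_cases i <;> simp <;> ring

theorem norm_cross_sub_cross_le (a b a' b' : E3) :
    ‖cross a' b' - cross a b‖ ≤ ‖a' - a‖ * ‖b'‖ + ‖a‖ * ‖b' - b‖ := by
  rw [cross_sub_cross]
  exact (norm_add_le _ _).trans (add_le_add (norm_cross_le _ _) (norm_cross_le _ _))

theorem continuous_cross : Continuous fun p : E3 × E3 => cross p.1 p.2 := by
  unfold cross
  refine (PiLp.continuous_toLp 2 _).comp (continuous_pi fun i => ?_)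
  fin_cases i <;> simp <;> fun_prop

/-! ### The direction of a vector -/

section Direction

variable {V : Type*} [NormedAddCommGroup V] [InnerProductSpace ℝ V]

def direction (x : V) : V := ‖x‖⁻¹ • x

theorem norm_smul_direction (x : V) : ‖x‖ • direction x = x := by
  rcases eq_or_ne x 0 with rfl | h
  · simp
  · rw [direction, smul_smul, mul_inv_cancel₀ (norm_ne_zero_iff.2 h), one_smul]

theorem norm_direction {x : V} (h : x ≠ 0) : ‖direction x‖ = 1 := by
  rw [direction, norm_smul, norm_inv, norm_norm, inv_mul_cancel₀ (norm_ne_zero_iff.2 h)]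

theorem norm_direction_le (x : V) : ‖direction x‖ ≤ 1 := by
  rcases eq_or_ne x 0 with rfl | h
  · simp [direction]
  · exact (norm_direction h).le

/-- Normalisation is not Lipschitz near the origin; the weight `‖x‖` repairs this, and it is the
weight that occurs in the slope of the objective. -/
theorem norm_mul_norm_direction_sub_le (x y : V) :
    ‖x‖ * ‖direction y - direction x‖ ≤ 2 * ‖y - x‖ := by
  have h : ‖x‖ • (direction y - direction x) = (‖x‖ - ‖y‖) • direction y + (y - x) := by
    rw [smul_sub, sub_smul, norm_smul_direction, norm_smul_direction]; abel
  calc ‖x‖ * ‖direction y - direction x‖ = ‖‖x‖ • (direction y - direction x)‖ := by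
        rw [norm_smul, norm_norm]
    _ ≤ |‖x‖ - ‖y‖| * ‖direction y‖ + ‖y - x‖ := by
        rw [h]
        refine (norm_add_le _ _).trans_eq ?_
        rw [norm_smul, Real.norm_eq_abs]
    _ ≤ ‖y - x‖ * 1 + ‖y - x‖ := by
        gcongr
        · rw [abs_sub_comm]; exact abs_norm_sub_norm_le y x
        · exact norm_direction_le y
    _ = 2 * ‖y - x‖ := by ring

theorem measurable_direction [MeasurableSpace V] [BorelSpace V] [SecondCountableTopology V] :
    Measurable (direction : V → V) :=
  measurable_norm.inv.smul measurable_id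

end Direction

/-! ### Isotropic moments -/

section Isotropy

variable {V : Type*} [NormedAddCommGroup V] [InnerProductSpace ℝ V]

/-- A homogeneous function that is invariant under linear isometries is a multiple of a power of
the norm. -/
theorem eq_norm_pow_mul_of_invariant {F : V → ℝ} {n : ℕ}
    (hR : ∀ (R : V ≃ₗᵢ[ℝ] V) x, F (R x) = F x)
    (hF : ∀ (c : ℝ) x, F (c • x) = c ^ n * F x) {e : V} (he : ‖e‖ = 1) (x : V) :
    F x = ‖x‖ ^ n * F e := by
  have h : ‖x‖ = ‖‖x‖ • e‖ := by rw [norm_smul, he, norm_norm, mul_one]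
  -- The reflection in the bisecting hyperplane carries `x` to `‖x‖ • e`, so a single isometry
  -- suffices.
  rw [← hF, ← hR ((ℝ ∙ (x - ‖x‖ • e))ᗮ.reflection) x, Submodule.reflection_sub h]

variable [MeasurableSpace V] [BorelSpace V] [FiniteDimensional ℝ V]

variable (V) in
/-- Lebesgue measure on the closed unit ball. -/
abbrev ballMeasure : Measure V := volume.restrict (Metric.closedBall 0 1)

instance : IsFiniteMeasure (ballMeasure V) :=
  ⟨by rw [Measure.restrict_apply_univ]; exact measure_closedBall_lt_top⟩

theorem measurePreserving_ballMeasure (R : V ≃ₗᵢ[ℝ] V) :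
    MeasurePreserving R (ballMeasure V) (ballMeasure V) := by
  have h := R.measurePreserving.restrict_preimage
    (Metric.isClosed_closedBall (x := (0 : V)) (ε := 1)).measurableSet
  simpa using h

theorem integral_ballMeasure_comp (R : V ≃ₗᵢ[ℝ] V) (F : V → ℝ) :
    ∫ y, F (R y) ∂ballMeasure V = ∫ y, F y ∂ballMeasure V :=
  (measurePreserving_ballMeasure R).integral_comp R.toHomeomorph.measurableEmbedding F

theorem ae_ballMeasure_norm_le : ∀ᵐ y ∂ballMeasure V, ‖y‖ ≤ 1 := by
  filter_upwards [ae_restrict_mem (Metric.isClosed_closedBall (x := (0 : V)) (ε := 1)).measurableSet]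
    with y hy
  simpa using hy

end Isotropy

/-! ### Polarisation of isotropic quadratic and quartic moments -/

section Polarization

variable {V : Type*} [NormedAddCommGroup V] [InnerProductSpace ℝ V]
variable {α : Type*} [MeasurableSpace α]

theorem integral_mul_inner_mul_inner {μ : Measure α} {h : α → ℝ} {g : α → V} {c : ℝ}
    (hi : ∀ x, Integrable (fun p => h p * ⟪g p, x⟫ ^ 2) μ)
    (hc : ∀ x, ∫ p, h p * ⟪g p, x⟫ ^ 2 ∂μ = ‖x‖ ^ 2 * c) (x y : V) :
    ∫ p, h p * (⟪g p, x⟫ * ⟪g p, y⟫) ∂μ = c * ⟪x, y⟫ := by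
  have e : ∀ p, h p * (⟪g p, x⟫ * ⟪g p, y⟫)
      = (1 / 4) * (h p * ⟪g p, x + y⟫ ^ 2 - h p * ⟪g p, x - y⟫ ^ 2) := by
    intro p; rw [inner_add_right, inner_sub_right]; ring
  simp_rw [e]
  rw [integral_const_mul, integral_sub (hi _) (hi _), hc, hc, norm_add_sq_real, norm_sub_sq_real]
  ring

/-- A quartic form that is a multiple of `‖x‖ ^ 4` polarises to the sum over the three pairings of
its arguments; the normalisation `3 * c` makes each pairing carry the coefficient `c`. -/
theorem integral_mul_inner_pow_four {μ : Measure α} {h : α → ℝ} {g : α → V} {c : ℝ}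
    (hi : ∀ x, Integrable (fun p => h p * ⟪g p, x⟫ ^ 4) μ)
    (hc : ∀ x, ∫ p, h p * ⟪g p, x⟫ ^ 4 ∂μ = ‖x‖ ^ 4 * (3 * c)) (x y z w : V) :
    ∫ p, h p * (⟪g p, x⟫ * ⟪g p, y⟫ * ⟪g p, z⟫ * ⟪g p, w⟫) ∂μ
      = c * (⟪x, y⟫ * ⟪z, w⟫ + ⟪x, z⟫ * ⟪y, w⟫ + ⟪x, w⟫ * ⟪y, z⟫) := by
  let F : V → α → ℝ := fun v p => h p * ⟪g p, v⟫ ^ 4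
  -- The signed sum of fourth powers over the eight sign patterns of `x ± y ± z ± w` leaves only the
  -- mixed term, with coefficient `8 · 4! = 192`.
  have e : (fun p => h p * (⟪g p, x⟫ * ⟪g p, y⟫ * ⟪g p, z⟫ * ⟪g p, w⟫))
      = fun p => (1 / 192) * (((F (x + y + z + w) - F (x + y + z - w))
          + (F (x + y - z - w) - F (x + y - z + w)))
          + ((F (x - y + z - w) - F (x - y + z + w))
          + (F (x - y - z + w) - F (x - y - z - w)))) p := by
    funext p
    simp only [F, inner_add_right, inner_sub_right, Pi.add_apply, Pi.sub_apply]
    ring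
  have hF : ∀ v, Integrable (F v) μ := hi
  have hcF : ∀ v, ∫ p, F v p ∂μ = ⟪v, v⟫ ^ 2 * (3 * c) := by
    intro v; rw [real_inner_self_eq_norm_sq]; simp only [F, hc]; ring
  rw [e, integral_const_mul]
  rw [integral_add' (((hF _).sub (hF _)).add ((hF _).sub (hF _)))
      (((hF _).sub (hF _)).add ((hF _).sub (hF _))),
    integral_add' ((hF _).sub (hF _)) ((hF _).sub (hF _)),
    integral_add' ((hF _).sub (hF _)) ((hF _).sub (hF _)),
    integral_sub' (hF _) (hF _), integral_sub' (hF _) (hF _), integral_sub' (hF _) (hF _),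
    integral_sub' (hF _) (hF _)]
  simp only [hcF, inner_add_right, inner_sub_right, inner_add_left, inner_sub_left,
    real_inner_comm x y, real_inner_comm x z, real_inner_comm x w, real_inner_comm y z,
    real_inner_comm y w, real_inner_comm z w]
  ring

end Polarization

/-! ### Moments of the direction of the cross product of two random points of the ball -/

abbrev ballPair : Measure (E3 × E3) := (ballMeasure E3).prod (ballMeasure E3)

def dirCross (p : E3 × E3) : E3 := direction (cross p.1 p.2)

theorem measurable_dirCross : Measurable dirCross :=
  measurable_direction.comp continuous_cross.measurable

theorem ae_ballPair_norm_le : ∀ᵐ p ∂ballPair, ‖p.1‖ ≤ 1 ∧ ‖p.2‖ ≤ 1 := by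
  have h1 : ∀ᵐ p ∂ballPair, ‖p.1‖ ≤ 1 :=
    Measure.quasiMeasurePreserving_fst.ae ae_ballMeasure_norm_le
  have h2 : ∀ᵐ p ∂ballPair, ‖p.2‖ ≤ 1 :=
    Measure.quasiMeasurePreserving_snd.ae ae_ballMeasure_norm_le
  exact h1.and h2

theorem ae_norm_cross_le : ∀ᵐ p ∂ballPair, ‖cross p.1 p.2‖ ≤ 1 := by
  filter_upwards [ae_ballPair_norm_le] with p hp
  exact (norm_cross_le _ _).trans (mul_le_one₀ hp.1 (norm_nonneg _) hp.2)

theorem abs_inner_dirCross_le (p : E3 × E3) (x : E3) : |⟪dirCross p, x⟫| ≤ ‖x‖ :=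
  (abs_real_inner_le_norm _ _).trans
    (mul_le_of_le_one_left (norm_nonneg _) (norm_direction_le _))

theorem measurable_inner_dirCross (x : E3) : Measurable fun p => ⟪dirCross p, x⟫ :=
  measurable_dirCross.inner_const

theorem measurable_norm_cross : Measurable fun p : E3 × E3 => ‖cross p.1 p.2‖ :=
  continuous_cross.norm.measurable

theorem integrable_norm_cross_mul {f : E3 × E3 → ℝ} (hf : Measurable f) {C : ℝ}
    (hC : ∀ p, |f p| ≤ C) : Integrable (fun p => ‖cross p.1 p.2‖ * f p) ballPair := by
  refine Integrable.of_bound (measurable_norm_cross.mul hf).aestronglyMeasurable C ?_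
  filter_upwards [ae_norm_cross_le] with p hp
  rw [norm_mul, norm_norm, Real.norm_eq_abs]
  exact (mul_le_of_le_one_left (abs_nonneg _) hp).trans (hC p)

theorem integrable_norm_cross_mul_inner_pow (n : ℕ) (x : E3) :
    Integrable (fun p => ‖cross p.1 p.2‖ * ⟪dirCross p, x⟫ ^ n) ballPair := by
  refine integrable_norm_cross_mul ((measurable_inner_dirCross x).pow_const n) (C := ‖x‖ ^ n) ?_
  intro p
  rw [abs_pow]
  exact pow_le_pow_left₀ (abs_nonneg _) (abs_inner_dirCross_le p x) n

/-- The mean area of the parallelogram spanned by two points of the ball (unnormalised). -/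
def meanArea : ℝ := ∫ p, ‖cross p.1 p.2‖ ∂ballPair

theorem integral_ballPair_comp (R : E3 ≃ₗᵢ[ℝ] E3) (F : E3 × E3 → ℝ) :
    ∫ p, F (R p.1, R p.2) ∂ballPair = ∫ p, F p ∂ballPair :=
  ((measurePreserving_ballMeasure R).prod (measurePreserving_ballMeasure R)).integral_comp
    (R.toHomeomorph.prodCongr R.toHomeomorph).measurableEmbedding F

theorem inner_dirCross_map_sq (R : E3 ≃ₗᵢ[ℝ] E3) (p : E3 × E3) (x : E3) :
    ⟪dirCross (R p.1, R p.2), R x⟫ ^ 2 = ⟪dirCross p, x⟫ ^ 2 := by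
  simp only [dirCross, direction, norm_cross_map, inner_smul_left, mul_pow, inner_cross_map_sq]

/-- The ball and the area weight are invariant under isometries. Only even powers are used because
an orientation-reversing isometry changes the sign of the cross product. -/
theorem exists_integral_inner_dirCross_pow (n : ℕ) :
    ∃ c : ℝ, ∀ x : E3, ∫ p, ‖cross p.1 p.2‖ * ⟪dirCross p, x⟫ ^ (2 * n) ∂ballPair
      = ‖x‖ ^ (2 * n) * c := by
  refine ⟨_, fun x => eq_norm_pow_mul_of_invariant
    (F := fun x => ∫ p, ‖cross p.1 p.2‖ * ⟪dirCross p, x⟫ ^ (2 * n) ∂ballPair)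
    (e := EuclideanSpace.single 0 1) ?_ ?_ (by simp) x⟩
  · intro R x
    rw [← integral_ballPair_comp R]
    simp only [norm_cross_map, pow_mul, inner_dirCross_map_sq]
  · intro c x
    rw [← integral_const_mul]
    congr 1; funext p
    rw [inner_smul_right]; ring

theorem sum_inner_single_sq (x : E3) : ∑ i, ⟪x, EuclideanSpace.single i (1 : ℝ)⟫ ^ 2 = ‖x‖ ^ 2 := by
  simp [EuclideanSpace.inner_single_right, EuclideanSpace.norm_sq_eq]

theorem inner_single_single (i j : Fin 3) :
    ⟪(EuclideanSpace.single i 1 : E3), EuclideanSpace.single j 1⟫ = if i = j then 1 else 0 := by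
  simp [EuclideanSpace.inner_single_right, eq_comm]

/-- Where the cross product vanishes its direction is 0 instead of a unit vector, but the weight
vanishes there too, so no null-set argument is needed. -/
theorem norm_cross_mul_norm_dirCross_pow (p : E3 × E3) (n : ℕ) :
    ‖cross p.1 p.2‖ * ‖dirCross p‖ ^ n = ‖cross p.1 p.2‖ := by
  rcases eq_or_ne (cross p.1 p.2) 0 with h | h
  · simp [h]
  · rw [dirCross, norm_direction h, one_pow, mul_one]

/-- Isotropy leaves one unknown constant; summing over an orthonormal basis gives the total weight
and so fixes it. -/
theorem integral_dirCross_two (x y : E3) :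
    ∫ p, ‖cross p.1 p.2‖ * (⟪dirCross p, x⟫ * ⟪dirCross p, y⟫) ∂ballPair
      = meanArea / 3 * ⟪x, y⟫ := by
  obtain ⟨c, hc⟩ := exists_integral_inner_dirCross_pow 1
  have hi := integrable_norm_cross_mul_inner_pow 2
  have key : meanArea = 3 * c := by
    have : meanArea = ∑ i, ∫ p, ‖cross p.1 p.2‖ *
        ⟪dirCross p, EuclideanSpace.single i (1 : ℝ)⟫ ^ 2 ∂ballPair := by
      rw [← integral_finsetSum _ fun i _ => hi _]
      simp only [← Finset.mul_sum, sum_inner_single_sq, norm_cross_mul_norm_dirCross_pow, meanArea]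
    rw [this]
    have hc' := fun i : Fin 3 => hc (EuclideanSpace.single i (1 : ℝ))
    simp only [mul_one] at hc'
    simp [hc']
  rw [key, integral_mul_inner_mul_inner (c := c) hi hc]
  ring

/-- As for the second moments, the constant comes from a trace: summing over all pairs of basis
vectors gives `meanArea` on one side and `(9 + 6) c / 3 = 5 c` on the other. -/
theorem integral_dirCross_four (x y z w : E3) :
    ∫ p, ‖cross p.1 p.2‖ *
        (⟪dirCross p, x⟫ * ⟪dirCross p, y⟫ * ⟪dirCross p, z⟫ * ⟪dirCross p, w⟫) ∂ballPair
      = meanArea / 15 * (⟪x, y⟫ * ⟪z, w⟫ + ⟪x, z⟫ * ⟪y, w⟫ + ⟪x, w⟫ * ⟪y, z⟫) := by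
  obtain ⟨c, hc⟩ := exists_integral_inner_dirCross_pow 2
  have hi := integrable_norm_cross_mul_inner_pow 4
  have h4 := integral_mul_inner_pow_four (c := c / 3) hi
    (fun x => by rw [mul_div_cancel₀ c (by norm_num : (3 : ℝ) ≠ 0)]; exact hc x)
  let e : Fin 3 → E3 := fun i => EuclideanSpace.single i 1
  have key : meanArea = 5 * c := by
    have hij : ∀ i j : Fin 3, Integrable (fun p => ‖cross p.1 p.2‖ *
        (⟪dirCross p, e i⟫ * ⟪dirCross p, e i⟫ * ⟪dirCross p, e j⟫ * ⟪dirCross p, e j⟫))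
        ballPair := by
      intro i j
      refine integrable_norm_cross_mul (((((measurable_inner_dirCross _).mul
        (measurable_inner_dirCross _)).mul (measurable_inner_dirCross _)).mul
        (measurable_inner_dirCross _))) (C := 1) fun p => ?_
      have hb : ∀ i, |⟪dirCross p, e i⟫| ≤ 1 := fun i =>
        (abs_inner_dirCross_le p _).trans_eq (by simp [e])
      rw [abs_mul, abs_mul, abs_mul]
      exact mul_le_one₀ (mul_le_one₀ (mul_le_one₀ (hb i) (abs_nonneg _) (hb i))
        (abs_nonneg _) (hb j)) (abs_nonneg _) (hb j)
    have : meanArea = ∑ i, ∑ j, ∫ p, ‖cross p.1 p.2‖ *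
        (⟪dirCross p, e i⟫ * ⟪dirCross p, e i⟫ * ⟪dirCross p, e j⟫ * ⟪dirCross p, e j⟫)
        ∂ballPair := by
      simp_rw [← fun i => integral_finsetSum Finset.univ fun j _ => hij i j]
      rw [← integral_finsetSum _ fun i _ => integrable_finsetSum _ fun j _ => hij i j, meanArea]
      congr 1; funext p
      have h2 := sum_inner_single_sq (dirCross p)
      have h : ∑ i, ∑ j, (⟪dirCross p, e i⟫ * ⟪dirCross p, e i⟫ * ⟪dirCross p, e j⟫
          * ⟪dirCross p, e j⟫) = ‖dirCross p‖ ^ 4 := by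
        rw [show ‖dirCross p‖ ^ 4 = ‖dirCross p‖ ^ 2 * ‖dirCross p‖ ^ 2 by ring, ← h2,
          Finset.sum_mul_sum]
        refine Finset.sum_congr rfl fun i _ => Finset.sum_congr rfl fun j _ => ?_
        simp only [e]; ring
      simp only [← Finset.mul_sum, h, norm_cross_mul_norm_dirCross_pow]
    rw [this]
    simp only [h4, e, inner_single_single, Fin.sum_univ_three]
    simp
    ring
  rw [h4, key]
  ring

/-! ### Slicing the unit ball of three-space -/

/-- The Euclidean plane. -/
abbrev E2 : Type := EuclideanSpace ℝ (Fin 2)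

/-- The point of three-space with first coordinate `p.1` and remaining coordinates `p.2`. -/
def joinCoords (p : ℝ × E2) : E3 := !₂[p.1, p.2 0, p.2 1]

/-- The last two coordinates. -/
def tailCoords (x : E3) : E2 := !₂[x 1, x 2]

@[simp] theorem joinCoords_apply_zero (p : ℝ × E2) : joinCoords p 0 = p.1 := rfl
@[simp] theorem joinCoords_apply_one (p : ℝ × E2) : joinCoords p 1 = p.2 0 := rfl
@[simp] theorem joinCoords_apply_two (p : ℝ × E2) : joinCoords p 2 = p.2 1 := rfl

@[simp] theorem tailCoords_joinCoords (p : ℝ × E2) : tailCoords (joinCoords p) = p.2 := by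
  ext i; fin_cases i <;> rfl

theorem joinCoords_tailCoords (x : E3) : joinCoords (x 0, tailCoords x) = x := by
  ext i; fin_cases i <;> rfl

theorem continuous_joinCoords : Continuous joinCoords := by
  unfold joinCoords
  refine (PiLp.continuous_toLp 2 _).comp (continuous_pi fun i => ?_)
  fin_cases i <;> simp <;> fun_prop

theorem continuous_tailCoords : Continuous tailCoords := by
  unfold tailCoords
  refine (PiLp.continuous_toLp 2 _).comp (continuous_pi fun i => ?_)
  fin_cases i <;> simp <;> fun_prop

theorem joinCoords_injective : Function.Injective joinCoords := by
  rintro ⟨t, y⟩ ⟨t', y'⟩ h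
  have h0 := congrArg (fun x : E3 => x 0) h
  have h1 := congrArg tailCoords h
  simp only [joinCoords_apply_zero, tailCoords_joinCoords] at h0 h1
  rw [h0, h1]

theorem norm_joinCoords_sq (t : ℝ) (y : E2) : ‖joinCoords (t, y)‖ ^ 2 = t ^ 2 + ‖y‖ ^ 2 := by
  simp [EuclideanSpace.norm_sq_eq, Fin.sum_univ_three, Fin.sum_univ_two]
  ring

theorem volume_preserving_joinCoords : MeasurePreserving joinCoords := by
  have h1 : MeasurePreserving (Prod.map id (WithLp.ofLp : E2 → (Fin 2 → ℝ)))
      ((volume : Measure ℝ).prod (volume : Measure E2)) (volume.prod volume) :=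
    (MeasurePreserving.id _).prod (PiLp.volume_preserving_ofLp (Fin 2))
  have h2 := (volume_preserving_piFinSuccAbove (fun _ : Fin 3 => ℝ) 0).symm
  have h3 := PiLp.volume_preserving_toLp (Fin 3)
  have h := h3.comp (h2.comp h1)
  have he : joinCoords = WithLp.toLp 2 ∘
      (MeasurableEquiv.piFinSuccAbove (fun _ : Fin 3 => ℝ) 0).symm ∘ Prod.map id WithLp.ofLp := by
    funext p
    ext i
    fin_cases i <;> rfl
  rw [he]
  exact h

/-- Integrals over the unit ball by slicing parallel to the first coordinate axis. -/
theorem integral_ball_slices {F : E3 → ℝ} (hF : Measurable F) {C : ℝ} (hC : ∀ x, |F x| ≤ C) :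
    Integrable (fun y : E2 => ∫ t in (-√(1 - ‖y‖ ^ 2))..√(1 - ‖y‖ ^ 2), F (joinCoords (t, y)))
      (ballMeasure E2) ∧
    ∫ x, F x ∂ballMeasure E3 =
      ∫ y, (∫ t in (-√(1 - ‖y‖ ^ 2))..√(1 - ‖y‖ ^ 2), F (joinCoords (t, y))) ∂ballMeasure E2 := by
  have hm3 : MeasurableSet (Metric.closedBall (0 : E3) 1) := Metric.isClosed_closedBall.measurableSet
  have hm2 : MeasurableSet (Metric.closedBall (0 : E2) 1) := Metric.isClosed_closedBall.measurableSet
  let Φ : ℝ × E2 → ℝ := fun p => (Metric.closedBall (0 : E3) 1).indicator F (joinCoords p)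
  have hemb := continuous_joinCoords.measurableEmbedding joinCoords_injective
  have hFi : Integrable ((Metric.closedBall (0 : E3) 1).indicator F) := by
    rw [integrable_indicator_iff hm3]
    exact Integrable.of_bound hF.aestronglyMeasurable C (ae_of_all _ hC)
  have hΦ : Integrable Φ (volume.prod volume) :=
    (volume_preserving_joinCoords.integrable_comp_emb hemb).2 hFi
  have hslice : ∀ y, ∫ t, Φ (t, y) = (Metric.closedBall (0 : E2) 1).indicator
      (fun y : E2 => ∫ t in (-√(1 - ‖y‖ ^ 2))..√(1 - ‖y‖ ^ 2), F (joinCoords (t, y))) y := by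
    intro y
    by_cases hy : y ∈ Metric.closedBall (0 : E2) 1
    · have hy1 : ‖y‖ ≤ 1 := by simpa using hy
      have h0 : 0 ≤ 1 - ‖y‖ ^ 2 := by nlinarith [norm_nonneg y]
      rw [Set.indicator_of_mem hy, intervalIntegral.integral_of_le (by
        linarith [Real.sqrt_nonneg (1 - ‖y‖ ^ 2)]), ← integral_Icc_eq_integral_Ioc,
        ← integral_indicator measurableSet_Icc]
      congr 1; funext t
      have : joinCoords (t, y) ∈ Metric.closedBall (0 : E3) 1 ↔
          t ∈ Set.Icc (-√(1 - ‖y‖ ^ 2)) √(1 - ‖y‖ ^ 2) := by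
        rw [mem_closedBall_zero_iff, Set.mem_Icc, ← abs_le, ← sq_le_one_iff₀ (norm_nonneg _),
          norm_joinCoords_sq, ← Real.sqrt_sq_eq_abs, Real.sqrt_le_sqrt_iff h0, le_sub_iff_add_le]
      simp only [Φ]
      by_cases ht : t ∈ Set.Icc (-√(1 - ‖y‖ ^ 2)) √(1 - ‖y‖ ^ 2)
      · rw [Set.indicator_of_mem ht, Set.indicator_of_mem (this.2 ht)]
      · rw [Set.indicator_of_notMem ht, Set.indicator_of_notMem (mt this.1 ht)]
    · have hy1 : 1 < ‖y‖ := by simpa using hy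
      rw [Set.indicator_of_notMem hy]
      have : ∀ t, Φ (t, y) = 0 := by
        intro t
        refine Set.indicator_of_notMem ?_ _
        rw [mem_closedBall_zero_iff, ← sq_le_one_iff₀ (norm_nonneg _), norm_joinCoords_sq]
        nlinarith [sq_nonneg t]
      simp [this]
  constructor
  · have h := hΦ.integral_prod_right
    simp_rw [hslice] at h
    exact (integrable_indicator_iff hm2).1 h
  · rw [← integral_indicator hm3, ← volume_preserving_joinCoords.integral_comp hemb,
      ← integral_indicator hm2]
    simp_rw [← hslice]
    exact integral_prod_symm _ hΦ

/-! ### Splitting the ball by a graph over the disc -/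

theorem integral_sign {a b : ℝ} (ha : a ≤ 0) (hb : 0 ≤ b) : ∫ t in a..b, Real.sign t = a + b := by
  have hi : ∀ c d : ℝ, IntervalIntegrable Real.sign volume c d := fun c d =>
    sign_mono.intervalIntegrable
  rw [← intervalIntegral.integral_add_adjacent_intervals (hi a 0) (hi 0 b),
    intervalIntegral.integral_of_le ha, intervalIntegral.integral_of_le hb,
    integral_Ioc_eq_integral_Ioo, setIntegral_congr_fun measurableSet_Ioo (g := fun _ => -1)
      (fun t ht => Real.sign_of_neg ht.2),
    setIntegral_congr_fun measurableSet_Ioc (g := fun _ => 1) (fun t ht => Real.sign_of_pos ht.1)]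
  simp [ha, hb]

/-- If the zero of `t + s` lies on the chord, the value `2 * s` is exact. Otherwise the integral is
at most the chord length `2 * h`, which is below `2 * |s|`. -/
theorem abs_integral_sign_add_sub_le {h s : ℝ} (hh : 0 ≤ h) :
    |(∫ t in (-h)..h, Real.sign (t + s)) - 2 * s| ≤ if h < |s| then 4 * |s| else 0 := by
  split_ifs with hs
  · have h1 : ‖∫ t in (-h)..h, Real.sign (t + s)‖ ≤ 1 * |h - -h| :=
      intervalIntegral.norm_integral_le_of_norm_le_const fun t _ => abs_sign_le _
    rw [one_mul, abs_of_nonneg (by linarith), Real.norm_eq_abs] at h1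
    refine (abs_sub _ _).trans ?_
    rw [abs_mul, abs_two]
    linarith
  · rw [intervalIntegral.integral_comp_add_right (fun t => Real.sign t), integral_sign]
    · rw [abs_le]; constructor <;> linarith
    · linarith [neg_abs_le s, le_abs_self s]
    · linarith [neg_abs_le s, le_abs_self s]

/-- Area of the unit disc. -/
def discArea : ℝ := (volume : Measure E2).real (Metric.closedBall 0 1)

theorem discArea_pos : 0 < discArea :=
  ENNReal.toReal_pos (Metric.measure_closedBall_pos _ _ one_pos).ne' measure_closedBall_lt_top.ne

theorem discArea_eq : discArea = (volume : Measure E2).real (Metric.ball 0 1) := by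
  rw [discArea, measureReal_def, Measure.addHaar_closedBall _ _ zero_le_one]
  simp [measureReal_def]

/-- This is the rim of the disc, where the half-chord is shorter than `c`: the only place where a
graph of height at most `c` can leave the ball. -/
theorem measureReal_annulus_le {c : ℝ} (hc : 0 ≤ c) :
    (ballMeasure E2).real {y | 1 - ‖y‖ ^ 2 < c ^ 2} ≤ discArea * c ^ 2 := by
  rw [measureReal_restrict_apply (measurableSet_lt (by fun_prop) (by fun_prop))]
  rcases le_total 1 c with h | h
  · calc _ ≤ discArea := measureReal_mono Set.inter_subset_right measure_closedBall_lt_top.ne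
      _ ≤ discArea * c ^ 2 := le_mul_of_one_le_right discArea_pos.le (one_le_pow₀ h)
  · have h0 : 0 ≤ 1 - c ^ 2 := by nlinarith
    have hsub : Metric.closedBall (0 : E2) √(1 - c ^ 2) ⊆ Metric.closedBall 0 1 :=
      Metric.closedBall_subset_closedBall (Real.sqrt_le_one.2 (by nlinarith))
    have hset : {y : E2 | 1 - ‖y‖ ^ 2 < c ^ 2} ∩ Metric.closedBall 0 1
        ⊆ Metric.closedBall 0 1 \ Metric.closedBall (0 : E2) √(1 - c ^ 2) := by
      rintro y ⟨hy, hy1⟩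
      refine ⟨hy1, fun h2 => ?_⟩
      rw [mem_closedBall_zero_iff] at h2
      have := Real.sq_sqrt h0 ▸ pow_le_pow_left₀ (norm_nonneg y) h2 2
      change 1 - ‖y‖ ^ 2 < c ^ 2 at hy
      linarith
    refine (measureReal_mono hset ((measure_mono Set.sdiff_subset).trans_lt
      measure_closedBall_lt_top).ne).trans_eq ?_
    rw [measureReal_sdiff hsub Metric.isClosed_closedBall.measurableSet
      measure_closedBall_lt_top.ne]
    have : (volume : Measure E2).real (Metric.closedBall 0 √(1 - c ^ 2)) = (1 - c ^ 2) * discArea := by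
      rw [discArea_eq, measureReal_def, Measure.addHaar_closedBall _ _ (Real.sqrt_nonneg _)]
      simp [measureReal_def, Real.sq_sqrt h0, h0]
    rw [this, discArea]
    ring

/-- Slicing along the first axis makes each chord contribute exactly twice the height, except over
the rim. There the error is at most `4 * c` on a set of area at most `discArea * c ^ 2`, hence
cubic. -/
theorem abs_integral_sign_graph_sub_le {s : E2 → ℝ} (hs : Measurable s) {c : ℝ} (hc : 0 ≤ c)
    (hsc : ∀ y, ‖y‖ ≤ 1 → |s y| ≤ c) :
    |(∫ x, Real.sign (x 0 + s (tailCoords x)) ∂ballMeasure E3) - 2 * ∫ y, s y ∂ballMeasure E2|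
      ≤ 4 * discArea * c ^ 3 := by
  have hx0 : Measurable fun x : E3 => x 0 := by fun_prop
  obtain ⟨hi, h⟩ := integral_ball_slices
    (F := fun x => Real.sign (x 0 + s (tailCoords x)))
    (measurable_sign.comp (hx0.add (hs.comp continuous_tailCoords.measurable)))
    (fun x => abs_sign_le _)
  simp only [joinCoords_apply_zero, tailCoords_joinCoords] at hi h
  have hsi : Integrable s (ballMeasure E2) :=
    Integrable.of_bound hs.aestronglyMeasurable c (ae_ballMeasure_norm_le.mono hsc)
  have hmeas : MeasurableSet {y : E2 | 1 - ‖y‖ ^ 2 < c ^ 2} :=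
    measurableSet_lt (by fun_prop) (by fun_prop)
  rw [h, ← integral_const_mul, ← integral_sub hi (hsi.const_mul 2)]
  have hb : ∀ᵐ y ∂ballMeasure E2,
      ‖(∫ t in (-√(1 - ‖y‖ ^ 2))..√(1 - ‖y‖ ^ 2), Real.sign (t + s y)) - 2 * s y‖
        ≤ {y : E2 | 1 - ‖y‖ ^ 2 < c ^ 2}.indicator (fun _ => 4 * c) y := by
    filter_upwards [ae_ballMeasure_norm_le] with y hy
    refine (abs_integral_sign_add_sub_le (Real.sqrt_nonneg _)).trans ?_
    split_ifs with hlt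
    · have hmem : y ∈ {y : E2 | 1 - ‖y‖ ^ 2 < c ^ 2} :=
        (Real.sqrt_lt' (((Real.sqrt_nonneg _).trans_lt hlt).trans_le (hsc y hy))).1
          (hlt.trans_le (hsc y hy))
      rw [Set.indicator_of_mem hmem]
      linarith [hsc y hy]
    · exact Set.indicator_nonneg (fun _ _ => by linarith) _
  refine (norm_integral_le_of_norm_le ((integrable_const _).indicator hmeas) hb).trans ?_
  rw [integral_indicator_const _ hmeas, smul_eq_mul]
  calc _ ≤ discArea * c ^ 2 * (4 * c) := by
        gcongr; exact measureReal_annulus_le hc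
    _ = 4 * discArea * c ^ 3 := by ring

/-! ### Measures of half-spaces under a perturbation of the identity -/

/-- The sign of `x 0 + ρ * g x` is in doubt only for `|x 0| ≤ C * ρ`, where `g` is within `η + L *
(C * ρ)` of a function of the tail coordinates alone. Monotonicity of the sign then squeezes the
integral between two graph integrals. Nothing is assumed about the shape or regularity of the zero
set. -/
theorem abs_integral_sign_perturb_sub_le {g : E3 → ℝ} (hg : Measurable g) {w : E2 → ℝ}
    (hw : Measurable w) {C L η ρ : ℝ} (hC : 0 ≤ C) (hL : 0 ≤ L) (hη : 0 ≤ η) (hρ : 0 < ρ)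
    (hgC : ∀ x, ‖x‖ ≤ 1 → |g x| ≤ C) (hwC : ∀ y, ‖y‖ ≤ 1 → |w y| ≤ C)
    (hgw : ∀ x, ‖x‖ ≤ 1 → |g x - w (tailCoords x)| ≤ η + L * |x 0|) :
    |(∫ x, Real.sign (x 0 + ρ * g x) ∂ballMeasure E3) - 2 * ρ * ∫ y, w y ∂ballMeasure E2|
      ≤ 2 * ρ * (η + L * (C * ρ)) * discArea
        + 4 * discArea * (ρ * (C + (η + L * (C * ρ)))) ^ 3 := by
  set δ := η + L * (C * ρ) with hδ
  have hδ0 : 0 ≤ δ := by positivity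
  have hx0 : Measurable fun x : E3 => x 0 := by fun_prop
  have hwi : Integrable w (ballMeasure E2) :=
    Integrable.of_bound hw.aestronglyMeasurable C (ae_ballMeasure_norm_le.mono hwC)
  have hwC' : ∀ y, ‖y‖ ≤ 1 → -C ≤ w y ∧ w y ≤ C := fun y hy => abs_le.1 (hwC y hy)
  have htail : ∀ x : E3, ‖x‖ ≤ 1 → ‖tailCoords x‖ ≤ 1 := by
    intro x hx
    have h := norm_joinCoords_sq (x 0) (tailCoords x)
    rw [joinCoords_tailCoords] at h
    nlinarith [norm_nonneg x, norm_nonneg (tailCoords x), sq_nonneg (x 0)]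
  have hsi : ∀ f : E3 → ℝ, Measurable f →
      Integrable (fun x => Real.sign (x 0 + f x)) (ballMeasure E3) := fun f hf =>
    Integrable.of_bound (measurable_sign.comp (hx0.add hf)).aestronglyMeasurable 1
      (ae_of_all _ fun x => abs_sign_le _)
  have hshift : ∀ d : ℝ, |d| ≤ δ →
      |(∫ x, Real.sign (x 0 + ρ * (w (tailCoords x) + d)) ∂ballMeasure E3)
        - 2 * ρ * ((∫ y, w y ∂ballMeasure E2) + d * discArea)|
        ≤ 4 * discArea * (ρ * (C + δ)) ^ 3 := by
    intro d hd
    have h := abs_integral_sign_graph_sub_le (s := fun y => ρ * (w y + d))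
      ((hw.add_const d).const_mul ρ) (c := ρ * (C + δ)) (by positivity) (fun y hy => by
        rw [abs_mul, abs_of_pos hρ]
        gcongr
        exact (abs_add_le _ _).trans (add_le_add (hwC y hy) hd))
    rw [integral_const_mul, integral_add hwi (integrable_const _), integral_const, smul_eq_mul,
      measureReal_restrict_apply_univ] at h
    convert h using 2
    rw [discArea]; ring
  have hwm : ∀ d : ℝ, Measurable fun x => ρ * (w (tailCoords x) + d) := fun d =>
    ((hw.comp continuous_tailCoords.measurable).add_const d).const_mul ρ
  have hup : ∫ x, Real.sign (x 0 + ρ * g x) ∂ballMeasure E3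
      ≤ ∫ x, Real.sign (x 0 + ρ * (w (tailCoords x) + δ)) ∂ballMeasure E3 := by
    refine integral_mono_ae (hsi _ (hg.const_mul ρ)) (hsi _ (hwm δ)) ?_
    filter_upwards [ae_ballMeasure_norm_le] with x hx
    obtain ⟨h1, h2⟩ := abs_le.1 (hgC x hx)
    obtain ⟨h3, h4⟩ := abs_le.1 (hgw x hx)
    obtain ⟨h5, h6⟩ := hwC' _ (htail x hx)
    rcases le_or_gt |x 0| (C * ρ) with h | h
    · refine sign_mono (add_le_add_right (mul_le_mul_of_nonneg_left ?_ hρ.le) _)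
      have := mul_le_mul_of_nonneg_left h hL
      linarith
    -- Away from the slab the term `x 0` dominates: either the upper sign is already 1 or the lower
    -- one is already -1.
    · rcases lt_abs.1 h with h | h
      · rw [Real.sign_of_pos (r := x 0 + ρ * (w (tailCoords x) + δ)) (by nlinarith)]
        exact (le_abs_self _).trans (abs_sign_le _)
      · rw [Real.sign_of_neg (r := x 0 + ρ * g x) (by nlinarith)]
        exact neg_le_of_abs_le (abs_sign_le _)
  have hlow : ∫ x, Real.sign (x 0 + ρ * (w (tailCoords x) + -δ)) ∂ballMeasure E3
      ≤ ∫ x, Real.sign (x 0 + ρ * g x) ∂ballMeasure E3 := by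
    refine integral_mono_ae (hsi _ (hwm (-δ))) (hsi _ (hg.const_mul ρ)) ?_
    filter_upwards [ae_ballMeasure_norm_le] with x hx
    obtain ⟨h1, h2⟩ := abs_le.1 (hgC x hx)
    obtain ⟨h3, h4⟩ := abs_le.1 (hgw x hx)
    obtain ⟨h5, h6⟩ := hwC' _ (htail x hx)
    rcases le_or_gt |x 0| (C * ρ) with h | h
    · refine sign_mono (add_le_add_right (mul_le_mul_of_nonneg_left ?_ hρ.le) _)
      have := mul_le_mul_of_nonneg_left h hL
      linarith
    · rcases lt_abs.1 h with h | h
      · rw [Real.sign_of_pos (r := x 0 + ρ * g x) (by nlinarith)]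
        exact (le_abs_self _).trans (abs_sign_le _)
      · rw [Real.sign_of_neg (r := x 0 + ρ * (w (tailCoords x) + -δ)) (by nlinarith)]
        exact neg_le_of_abs_le (abs_sign_le _)
  have h1 := abs_le.1 (hshift δ (abs_of_nonneg hδ0).le)
  have h2 := abs_le.1 (hshift (-δ) (by rw [abs_neg]; exact (abs_of_nonneg hδ0).le))
  rw [abs_le]
  constructor <;> linarith [h1.1, h1.2, h2.1, h2.2]

/-! ### Second moments of the disc and the half-space coefficient -/

theorem integral_disc_norm_sq : ∫ y, ‖y‖ ^ 2 ∂ballMeasure E2 = discArea / 2 := by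
  have h := integral_fun_norm_addHaar (volume : Measure E2)
    (fun r => (Set.Iic (1 : ℝ)).indicator (fun r => r ^ 2) r)
  have h1 : ∫ r in Set.Ioi (0 : ℝ), r ^ (Module.finrank ℝ E2 - 1) •
      (Set.Iic (1 : ℝ)).indicator (fun r => r ^ 2) r = 1 / 4 := by
    have : ∀ r : ℝ, r ^ (Module.finrank ℝ E2 - 1) • (Set.Iic (1 : ℝ)).indicator (fun r => r ^ 2) r
        = (Set.Iic (1 : ℝ)).indicator (fun r => r ^ 3) r := by
      intro r
      rw [finrank_euclideanSpace_fin]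
      by_cases hr : r ∈ Set.Iic (1 : ℝ)
      · rw [Set.indicator_of_mem hr, Set.indicator_of_mem hr, smul_eq_mul]; ring
      · rw [Set.indicator_of_notMem hr, Set.indicator_of_notMem hr, smul_zero]
    simp_rw [this]
    rw [setIntegral_indicator measurableSet_Iic, Set.Ioi_inter_Iic,
      ← intervalIntegral.integral_of_le zero_le_one, integral_pow]
    norm_num
  rw [h1, ← discArea_eq, finrank_euclideanSpace_fin] at h
  rw [← integral_indicator Metric.isClosed_closedBall.measurableSet]
  have h2 : ∀ y : E2, (Metric.closedBall (0 : E2) 1).indicator (fun y => ‖y‖ ^ 2) y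
      = (Set.Iic (1 : ℝ)).indicator (fun r => r ^ 2) ‖y‖ := by
    intro y
    by_cases hy : ‖y‖ ≤ 1
    · rw [Set.indicator_of_mem (by simpa using hy), Set.indicator_of_mem (Set.mem_Iic.2 hy)]
    · rw [Set.indicator_of_notMem (by simpa using hy), Set.indicator_of_notMem (by simpa using hy)]
  simp_rw [h2]
  rw [h]
  simp
  ring

theorem integral_disc_inner_mul_inner (x z : E2) :
    ∫ y, ⟪y, x⟫ * ⟪y, z⟫ ∂ballMeasure E2 = discArea / 4 * ⟪x, z⟫ := by
  have hi : ∀ x : E2, Integrable (fun y => (1 : ℝ) * ⟪y, x⟫ ^ 2) (ballMeasure E2) := by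
    intro x
    refine Integrable.of_bound (by fun_prop) (‖x‖ ^ 2) ?_
    filter_upwards [ae_ballMeasure_norm_le] with y hy
    rw [one_mul, norm_pow]
    exact pow_le_pow_left₀ (norm_nonneg _) ((norm_inner_le_norm _ _).trans
      (mul_le_of_le_one_left (norm_nonneg _) hy)) 2
  obtain ⟨c, hc⟩ : ∃ c : ℝ, ∀ x : E2, ∫ y, (1 : ℝ) * ⟪y, x⟫ ^ 2 ∂ballMeasure E2 = ‖x‖ ^ 2 * c := by
    refine ⟨_, fun x => eq_norm_pow_mul_of_invariant
      (F := fun x => ∫ y, (1 : ℝ) * ⟪y, x⟫ ^ 2 ∂ballMeasure E2)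
      (e := EuclideanSpace.single 0 1) ?_ ?_ (by simp) x⟩
    · intro R x
      rw [← integral_ballMeasure_comp R]
      simp only [R.inner_map_map]
    · intro c x
      rw [← integral_const_mul]
      congr 1; funext p
      rw [inner_smul_right]; ring
  have key : discArea / 2 = 2 * c := by
    have hn : ∀ y : E2, ‖y‖ ^ 2 = ∑ i, (1 : ℝ) * ⟪y, EuclideanSpace.single i (1 : ℝ)⟫ ^ 2 := by
      intro y
      simp [EuclideanSpace.inner_single_right, EuclideanSpace.norm_sq_eq]
    rw [← integral_disc_norm_sq]
    simp_rw [hn]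
    rw [integral_finsetSum _ fun i _ => hi _]
    simp only [hc, Fin.sum_univ_two, PiLp.norm_single]
    norm_num
    ring
  have h := integral_mul_inner_mul_inner hi hc x z
  simp only [one_mul] at h
  rw [h]
  linear_combination (-⟪x, z⟫ / 2) * key

/-- The trace of a bilinear map. -/
def traceBilin (Q : E3 →L[ℝ] E3 →L[ℝ] E3) : E3 :=
  ∑ i, Q (EuclideanSpace.single i 1) (EuclideanSpace.single i 1)

/-- The tensor `∑ eᵢ ⊗ eᵢ` is the same for every orthonormal basis. -/
theorem traceBilin_eq_sum (Q : E3 →L[ℝ] E3 →L[ℝ] E3) (S : E3 ≃ₗᵢ[ℝ] E3) :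
    traceBilin Q = ∑ i, Q (S (EuclideanSpace.single i 1)) (S (EuclideanSpace.single i 1)) := by
  let B : E3 →ₗ[ℝ] E3 →ₗ[ℝ] E3 :=
    LinearMap.mk₂ ℝ (fun x y => Q x y) (by simp) (by simp) (by simp) (by simp)
  have h1 := InnerProductSpace.canonicalCovariantTensor_eq_sum E3
    (EuclideanSpace.basisFun (Fin 3) ℝ)
  have h2 := InnerProductSpace.canonicalCovariantTensor_eq_sum E3
    ((EuclideanSpace.basisFun (Fin 3) ℝ).map S)
  have h := congrArg (TensorProduct.lift B) (h1.symm.trans h2)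
  simpa [B, traceBilin] using h

/-- The first-order coefficient of the difference of the masses of the half-spaces on both sides of
a plane with unit normal `ν`, for the image of the ball under `y ↦ y + Q(y, y)/2 - k`. -/
def halfSpaceCoeff (Q : E3 →L[ℝ] E3 →L[ℝ] E3) (k ν : E3) : ℝ :=
  1 / 8 * ⟪ν, traceBilin Q - Q ν ν⟫ - ⟪ν, k⟫

/-- The disc moments replace `Q(y, y)` by a quarter of the trace over the two tangential directions,
that is, the full trace minus the entry at the normal. With the factor `1 / 2` this produces the `1
/ 8`. -/
theorem integral_disc_quadratic (Q : E3 →L[ℝ] E3 →L[ℝ] E3) (k : E3) (S : E3 ≃ₗᵢ[ℝ] E3) :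
    ∫ y : E2, (1 / 2 * ⟪S (EuclideanSpace.single 0 1), Q (S (joinCoords (0, y)))
        (S (joinCoords (0, y)))⟫ - ⟪S (EuclideanSpace.single 0 1), k⟫) ∂ballMeasure E2
      = discArea * halfSpaceCoeff Q k (S (EuclideanSpace.single 0 1)) := by
  set ν := S (EuclideanSpace.single 0 1) with hν
  set f : Fin 3 → E3 := fun i => S (EuclideanSpace.single i 1) with hf
  have hj : ∀ y : E2, S (joinCoords (0, y)) = y 0 • f 1 + y 1 • f 2 := by
    intro y
    simp only [hf, ← map_smul, ← map_add]
    congr 1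
    ext i; fin_cases i <;> simp
  let e : Fin 2 → E2 := fun i => EuclideanSpace.single i 1
  have he : ∀ (y : E2) i, y i = ⟪y, e i⟫ := by
    intro y i; simp [e, EuclideanSpace.inner_single_right]
  have hi : ∀ i j, Integrable (fun y : E2 => ⟪y, e i⟫ * ⟪y, e j⟫) (ballMeasure E2) := by
    intro i j
    refine Integrable.of_bound (by fun_prop) (‖e i‖ * ‖e j‖) ?_
    filter_upwards [ae_ballMeasure_norm_le] with y hy
    rw [norm_mul]
    gcongr <;> exact (norm_inner_le_norm _ _).trans (mul_le_of_le_one_left (norm_nonneg _) hy)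
  have hexp : ∀ y : E2, 1 / 2 * ⟪ν, Q (S (joinCoords (0, y))) (S (joinCoords (0, y)))⟫ - ⟪ν, k⟫
      = ∑ i : Fin 2, ∑ j : Fin 2,
          1 / 2 * ⟪ν, Q (f i.succ) (f j.succ)⟫ * (⟪y, e i⟫ * ⟪y, e j⟫) - ⟪ν, k⟫ := by
    intro y
    rw [hj]
    simp only [Fin.sum_univ_two, ← he, map_add, map_smul, inner_add_right,
      inner_smul_right, _root_.add_apply, _root_.smul_apply]
    simp
    ring
  simp_rw [hexp]
  have htr := congrArg (fun v => ⟪ν, v⟫) (traceBilin_eq_sum Q S)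
  simp only [Fin.sum_univ_three, inner_add_right] at htr
  rw [integral_sub (integrable_finsetSum _ fun i _ => integrable_finsetSum _ fun j _ =>
    (hi i j).const_mul _) (integrable_const _)]
  rw [integral_finsetSum _ fun i _ => integrable_finsetSum _ fun j _ => (hi i j).const_mul _]
  simp_rw [fun i => integral_finsetSum Finset.univ fun j (_ : j ∈ Finset.univ) =>
    (hi i j).const_mul (1 / 2 * ⟪ν, Q (f i.succ) (f j.succ)⟫), integral_const_mul,
    integral_disc_inner_mul_inner]
  rw [integral_const, smul_eq_mul, measureReal_restrict_apply_univ, halfSpaceCoeff, ← discArea,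
    inner_sub_right, htr]
  simp [Fin.sum_univ_two, e, EuclideanSpace.inner_single_right, hf]
  ring

/-- Difference of the masses of the half-spaces on both sides of the plane through `n` with normal
vector `ν`, for the image of the uniform distribution on the unit ball under `w`. -/
def halfSpaceDiff (w : E3 → E3) (n ν : E3) : ℝ :=
  ∫ c, Real.sign ⟪ν, w c - n⟫ ∂ballMeasure E3

theorem halfSpaceDiff_direction (w : E3 → E3) (n ν : E3) :
    halfSpaceDiff w n (direction ν) = halfSpaceDiff w n ν := by
  rcases eq_or_ne ν 0 with rfl | h
  · simp [direction]
  · simp only [halfSpaceDiff, direction, inner_smul_left]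
    congr 1; funext c
    exact sign_mul_of_pos (inv_pos.2 (norm_pos_iff.2 h)) _

theorem norm_bilin_sub_le (Q : E3 →L[ℝ] E3 →L[ℝ] E3) {x y : E3} (hx : ‖x‖ ≤ 1) (hy : ‖y‖ ≤ 1) :
    ‖Q x x - Q y y‖ ≤ 2 * ‖Q‖ * ‖x - y‖ := by
  have h : Q x x - Q y y = Q (x - y) x + Q y (x - y) := by
    simp only [map_sub, _root_.sub_apply]; abel
  calc ‖Q x x - Q y y‖ ≤ ‖Q‖ * ‖x - y‖ * ‖x‖ + ‖Q‖ * ‖y‖ * ‖x - y‖ := by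
        rw [h]
        exact (norm_add_le _ _).trans (add_le_add (Q.le_opNorm₂ _ _) (Q.le_opNorm₂ _ _))
    _ ≤ ‖Q‖ * ‖x - y‖ * 1 + ‖Q‖ * 1 * ‖x - y‖ := by gcongr
    _ = 2 * ‖Q‖ * ‖x - y‖ := by ring

/-- `w` agrees with `y ↦ y + (ρ / 2) Q(y, y)` on the unit ball up to an error of `η ρ`. -/
def ApproxQuadratic (Q : E3 →L[ℝ] E3 →L[ℝ] E3) (η ρ : ℝ) (w : E3 → E3) : Prop :=
  ∀ y, ‖y‖ ≤ 1 → ‖w y - (y + (ρ / 2) • Q y y)‖ ≤ η * ρ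

theorem abs_halfSpaceDiff_sub_le_of_norm_eq_one {Q : E3 →L[ℝ] E3 →L[ℝ] E3} {w : E3 → E3}
    (hw : Measurable w) {η ρ K : ℝ} (hη : 0 ≤ η) (hη1 : η ≤ 1) (hρ : 0 < ρ)
    (hQ : ApproxQuadratic Q η ρ w) {k : E3} (hk : ‖k‖ ≤ K) {ν : E3} (hν : ‖ν‖ = 1) :
    |halfSpaceDiff w (ρ • k) ν - 2 * ρ * (discArea * halfSpaceCoeff Q k ν)| ≤
      2 * ρ * (η + ‖Q‖ * ((‖Q‖ + K + 1) * ρ)) * discArea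
        + 4 * discArea * (ρ * ((‖Q‖ + K + 1) + (η + ‖Q‖ * ((‖Q‖ + K + 1) * ρ)))) ^ 3 := by
  have hK : 0 ≤ K := (norm_nonneg k).trans hk
  have hνe : ‖ν‖ = ‖(EuclideanSpace.single 0 1 : E3)‖ := by simp [hν]
  obtain ⟨S, hS⟩ : ∃ S : E3 ≃ₗᵢ[ℝ] E3, S (EuclideanSpace.single 0 1) = ν :=
    ⟨_, Submodule.reflection_sub hνe.symm⟩
  have hinner : ∀ x, ⟪ν, S x⟫ = x 0 := by
    intro x
    rw [← hS, S.inner_map_map, EuclideanSpace.inner_single_left]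
    simp
  -- With `ν` rotated to the first axis, `g` is the exact normal displacement divided by `ρ` and `p`
  -- is its quadratic model.
  let p : E3 → ℝ := fun x => 1 / 2 * ⟪ν, Q (S x) (S x)⟫ - ⟪ν, k⟫
  let g : E3 → ℝ := fun x => ρ⁻¹ * (⟪ν, w (S x)⟫ - x 0) - ⟪ν, k⟫
  have hgm : Measurable g := by
    have h0 : Measurable fun x : E3 => x 0 := by fun_prop
    have h1 : Measurable fun x : E3 => ⟪ν, w (S x)⟫ :=
      (hw.comp S.continuous.measurable).const_inner
    exact ((h1.sub h0).const_mul _).sub_const _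
  have hpc : Continuous p := by fun_prop
  have hgp : ∀ x, ‖x‖ ≤ 1 → |g x - p x| ≤ η := by
    intro x hx
    have h := (abs_real_inner_le_norm ν _).trans
      (mul_le_mul hν.le (hQ (S x) (by rwa [S.norm_map])) (norm_nonneg _) zero_le_one)
    rw [inner_sub_right, inner_add_right, hinner, inner_smul_right] at h
    have he : g x - p x = ρ⁻¹ * (⟪ν, w (S x)⟫ - (x 0 + ρ / 2 * ⟪ν, Q (S x) (S x)⟫)) := by
      simp only [g, p]; field_simp; ring
    rw [he, abs_mul, abs_inv, abs_of_pos hρ, inv_mul_le_iff₀ hρ]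
    linarith
  have hpb : ∀ x, ‖x‖ ≤ 1 → |p x| ≤ ‖Q‖ + K := by
    intro x hx
    have h1 : |⟪ν, Q (S x) (S x)⟫| ≤ ‖Q‖ := by
      refine (abs_real_inner_le_norm _ _).trans ?_
      rw [hν, one_mul]
      refine (Q.le_opNorm₂ _ _).trans ?_
      rw [S.norm_map, mul_assoc]
      exact mul_le_of_le_one_right Q.opNorm_nonneg (mul_le_one₀ hx (norm_nonneg _) hx)
    have h2 : |⟪ν, k⟫| ≤ K := (abs_real_inner_le_norm _ _).trans (by rwa [hν, one_mul])
    rw [abs_le] at *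
    constructor <;> simp only [p] <;> linarith [h1.1, h1.2, h2.1, h2.2, norm_nonneg Q]
  have htail : ∀ x : E3, ‖x‖ ≤ 1 → ‖joinCoords (0, tailCoords x)‖ ≤ 1 := by
    intro x hx
    have h1 := norm_joinCoords_sq (x 0) (tailCoords x)
    have h2 := norm_joinCoords_sq 0 (tailCoords x)
    rw [joinCoords_tailCoords] at h1
    nlinarith [norm_nonneg x, norm_nonneg (joinCoords (0, tailCoords x)), sq_nonneg (x 0)]
  have hplip : ∀ x, ‖x‖ ≤ 1 → |p x - p (joinCoords (0, tailCoords x))| ≤ ‖Q‖ * |x 0| := by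
    intro x hx
    have hd : x - joinCoords (0, tailCoords x) = EuclideanSpace.single 0 (x 0) := by
      ext i; fin_cases i <;> simp [tailCoords]
    have h1 := norm_bilin_sub_le Q (x := S x) (y := S (joinCoords (0, tailCoords x)))
      (by rwa [S.norm_map]) (by rw [S.norm_map]; exact htail x hx)
    rw [← map_sub, S.norm_map, hd, PiLp.norm_single, Real.norm_eq_abs] at h1
    have h2 := (abs_real_inner_le_norm ν (Q (S x) (S x) - Q (S (joinCoords (0, tailCoords x)))
      (S (joinCoords (0, tailCoords x)))))
    rw [hν, one_mul, inner_sub_right] at h2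
    have he : p x - p (joinCoords (0, tailCoords x)) = 1 / 2 * (⟪ν, Q (S x) (S x)⟫ -
        ⟪ν, Q (S (joinCoords (0, tailCoords x))) (S (joinCoords (0, tailCoords x)))⟫) := by
      simp only [p]; ring
    rw [he, abs_mul, abs_of_pos (by norm_num : (0 : ℝ) < 1 / 2)]
    linarith
  have hnj : ∀ y : E2, ‖y‖ ≤ 1 → ‖joinCoords (0, y)‖ ≤ 1 := by
    intro y hy
    have h2 := norm_joinCoords_sq 0 y
    nlinarith [norm_nonneg y, norm_nonneg (joinCoords (0, y))]
  -- The summand 1 in `C` pays for the deviation `η ≤ 1` of `g` from `p`; `L` bounds the change of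
  -- `p` on projecting to the central disc.
  have hmain := abs_integral_sign_perturb_sub_le (C := ‖Q‖ + K + 1) (L := ‖Q‖) (η := η) (ρ := ρ)
    (w := fun y => p (joinCoords (0, y))) hgm
    (hpc.comp (continuous_joinCoords.comp (by fun_prop))).measurable
    (by positivity) Q.opNorm_nonneg hη hρ
    (fun x hx => by
      have := abs_sub_abs_le_abs_sub (g x) (p x)
      linarith [hgp x hx, hpb x hx])
    (fun y hy => by linarith [hpb _ (hnj y hy)])
    (fun x hx => (abs_sub_le _ (p x) _).trans (add_le_add (hgp x hx) (hplip x hx)))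
  have hdisc : ∫ y, p (joinCoords (0, y)) ∂ballMeasure E2 = discArea * halfSpaceCoeff Q k ν := by
    have := integral_disc_quadratic Q k S
    rwa [hS] at this
  have hsign : ∫ x, Real.sign (x 0 + ρ * g x) ∂ballMeasure E3 = halfSpaceDiff w (ρ • k) ν := by
    rw [halfSpaceDiff, ← integral_ballMeasure_comp S fun x => Real.sign ⟪ν, w x - ρ • k⟫]
    congr 1; funext x
    congr 1
    simp only [g, inner_sub_right, inner_smul_right]
    field_simp
    ring
  rwa [hdisc, hsign] at hmain

/-- The half-space estimate, uniformly in the normal vector. -/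
theorem exists_abs_halfSpaceDiff_sub_le (Q : E3 →L[ℝ] E3 →L[ℝ] E3) {K : ℝ} (hK : 0 ≤ K) :
    ∃ M : ℝ, 0 ≤ M ∧ ∀ (w : E3 → E3) (η ρ : ℝ) (k ν : E3), Measurable w → 0 ≤ η → η ≤ 1 → 0 < ρ →
      ρ ≤ 1 → ApproxQuadratic Q η ρ w → ‖k‖ ≤ K →
      |halfSpaceDiff w (ρ • k) ν - 2 * ρ * (discArea * halfSpaceCoeff Q k (direction ν))|
        ≤ M * (ρ * (η + ρ)) := by
  set C := ‖Q‖ + K + 1 with hC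
  have hC0 : 0 ≤ C := by positivity
  have hd := discArea_pos.le
  refine ⟨2 * (1 + ‖Q‖ * C) * discArea + 4 * discArea * (C + (1 + ‖Q‖ * C)) ^ 3, by positivity, ?_⟩
  intro w η ρ k ν hw hη hη1 hρ hρ1 hQ hk
  rcases eq_or_ne ν 0 with rfl | hν
  · have h1 : halfSpaceDiff w (ρ • k) 0 = 0 := by simp [halfSpaceDiff]
    have h2 : halfSpaceCoeff Q k (direction 0) = 0 := by simp [halfSpaceCoeff, direction]
    rw [h1, h2]
    simp only [mul_zero, sub_zero, abs_zero]
    positivity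
  · rw [← halfSpaceDiff_direction]
    refine (abs_halfSpaceDiff_sub_le_of_norm_eq_one hw hη hη1 hρ hQ hk
      (norm_direction hν)).trans ?_
    rw [← hC]
    have hb : 0 ≤ ‖Q‖ * C := by positivity
    have h1 : η + ‖Q‖ * (C * ρ) ≤ (1 + ‖Q‖ * C) * (η + ρ) := by nlinarith
    have h2 : η + ‖Q‖ * (C * ρ) ≤ 1 + ‖Q‖ * C := by nlinarith
    -- The rim error is of order `ρ ^ 3`, and `ρ ≤ 1` gives `ρ * ρ ≤ η + ρ`.
    have h3 : (ρ * (C + (η + ‖Q‖ * (C * ρ)))) ^ 3 ≤ (C + (1 + ‖Q‖ * C)) ^ 3 * (ρ * (η + ρ)) := by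
      calc (ρ * (C + (η + ‖Q‖ * (C * ρ)))) ^ 3 ≤ (ρ * (C + (1 + ‖Q‖ * C))) ^ 3 := by gcongr
        _ = (C + (1 + ‖Q‖ * C)) ^ 3 * (ρ * (ρ * ρ)) := by ring
        _ ≤ (C + (1 + ‖Q‖ * C)) ^ 3 * (ρ * (η + ρ)) := by
            gcongr
            nlinarith
    calc _ ≤ 2 * ρ * ((1 + ‖Q‖ * C) * (η + ρ)) * discArea
          + 4 * discArea * ((C + (1 + ‖Q‖ * C)) ^ 3 * (ρ * (η + ρ))) := by gcongr
      _ = _ := by ring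

/-! ### Asymptotics of the slope of the objective -/

/-- The first-order displacement of the median for a perturbation `y ↦ y + (ρ / 2) Q(y, y)` of the
unit ball. -/
def medianShift (Q : E3 →L[ℝ] E3 →L[ℝ] E3) : E3 :=
  WithLp.toLp 2 fun j => 1 / 10 * traceBilin Q j
    - 1 / 20 * ∑ i, Q (EuclideanSpace.single i 1) (EuclideanSpace.single j 1) i

theorem integrable_dirCross_two (x y : E3) : Integrable
    (fun p => ‖cross p.1 p.2‖ * (⟪dirCross p, x⟫ * ⟪dirCross p, y⟫)) ballPair := by
  refine integrable_norm_cross_mul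
    ((measurable_inner_dirCross x).mul (measurable_inner_dirCross y)) (C := ‖x‖ * ‖y‖) fun p => ?_
  rw [abs_mul]
  exact mul_le_mul (abs_inner_dirCross_le p x) (abs_inner_dirCross_le p y) (abs_nonneg _)
    (norm_nonneg _)

theorem integrable_dirCross_four (x y z w : E3) : Integrable (fun p => ‖cross p.1 p.2‖ *
    (⟪dirCross p, x⟫ * ⟪dirCross p, y⟫ * ⟪dirCross p, z⟫ * ⟪dirCross p, w⟫)) ballPair := by
  refine integrable_norm_cross_mul ((((measurable_inner_dirCross x).mul
    (measurable_inner_dirCross y)).mul (measurable_inner_dirCross z)).mul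
    (measurable_inner_dirCross w)) (C := ‖x‖ * ‖y‖ * ‖z‖ * ‖w‖) fun p => ?_
  rw [abs_mul, abs_mul, abs_mul]
  gcongr <;> exact abs_inner_dirCross_le p _

theorem sum_smul_single (x : E3) :
    x = x 0 • EuclideanSpace.single 0 1 + x 1 • EuclideanSpace.single 1 1
      + x 2 • EuclideanSpace.single 2 1 := by
  ext i; fin_cases i <;> simp

/-- Expanding `Q` in the standard basis turns the leading-order integrand into area-weighted
monomials of degree two and four in the direction of the cross product. -/
theorem inner_cross_mul_halfSpaceCoeff (Q : E3 →L[ℝ] E3 →L[ℝ] E3) (k e : E3) (p : E3 × E3) :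
    ⟪cross p.1 p.2, e⟫ * halfSpaceCoeff Q k (dirCross p)
      = 1 / 8 * (‖cross p.1 p.2‖ * (⟪dirCross p, e⟫ * ⟪dirCross p, traceBilin Q⟫))
        - 1 / 8 * ∑ i : Fin 3, ∑ j : Fin 3, ‖cross p.1 p.2‖ *
          (⟪dirCross p, Q (EuclideanSpace.single i 1) (EuclideanSpace.single j 1)⟫ *
            ⟪dirCross p, EuclideanSpace.single i 1⟫ * ⟪dirCross p, EuclideanSpace.single j 1⟫ *
            ⟪dirCross p, e⟫)
        - ‖cross p.1 p.2‖ * (⟪dirCross p, e⟫ * ⟪dirCross p, k⟫) := by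
  have h1 : ⟪cross p.1 p.2, e⟫ = ‖cross p.1 p.2‖ * ⟪dirCross p, e⟫ := by
    conv_lhs => rw [← norm_smul_direction (cross p.1 p.2)]
    rw [inner_smul_left]; rfl
  have h2 : ∀ n : E3, ⟪n, Q n n⟫ = ∑ i : Fin 3, ∑ j : Fin 3,
      ⟪n, Q (EuclideanSpace.single i 1) (EuclideanSpace.single j 1)⟫ *
        ⟪n, EuclideanSpace.single i 1⟫ * ⟪n, EuclideanSpace.single j 1⟫ := by
    intro n
    have hn : Q n n = Q (n 0 • EuclideanSpace.single 0 1 + n 1 • EuclideanSpace.single 1 1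
        + n 2 • EuclideanSpace.single 2 1) (n 0 • EuclideanSpace.single 0 1
        + n 1 • EuclideanSpace.single 1 1 + n 2 • EuclideanSpace.single 2 1) := by
      rw [← sum_smul_single n]
    rw [hn]
    simp only [map_add, map_smul, _root_.add_apply, _root_.smul_apply, inner_add_right,
      inner_smul_right, Fin.sum_univ_three, EuclideanSpace.inner_single_right]
    simp
    ring
  rw [h1, halfSpaceCoeff, inner_sub_right, h2]
  simp only [← Finset.mul_sum, ← Finset.sum_mul]
  ring

/-- Relative to `meanArea / 3`, the quadratic moments give `1 / 8` of the trace, and the quartic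
ones subtract `1 / 40` of the trace plus twice the contraction of `Q`. The two contractions agree by
symmetry, which leaves the coefficients `1 / 10` and `1 / 20`. -/
theorem integral_inner_cross_mul_halfSpaceCoeff {Q : E3 →L[ℝ] E3 →L[ℝ] E3}
    (hQ : ∀ x y, Q x y = Q y x) (k e : E3) :
    ∫ p, ⟪cross p.1 p.2, e⟫ * halfSpaceCoeff Q k (dirCross p) ∂ballPair
      = meanArea / 3 * ⟪medianShift Q - k, e⟫ := by
  simp_rw [inner_cross_mul_halfSpaceCoeff]
  have h4 := fun i j : Fin 3 => integrable_dirCross_four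
    (Q (EuclideanSpace.single i 1) (EuclideanSpace.single j 1)) (EuclideanSpace.single i 1)
    (EuclideanSpace.single j 1) e
  have h4' := integrable_finsetSum Finset.univ fun i _ =>
    integrable_finsetSum Finset.univ fun j _ => h4 i j
  refine (integral_sub (((integrable_dirCross_two _ _).const_mul _).sub (h4'.const_mul _))
    (integrable_dirCross_two _ _)).trans ?_
  rw [integral_sub' ((integrable_dirCross_two _ _).const_mul _)
    (h4'.const_mul _), integral_const_mul, integral_const_mul,
    integral_finsetSum _ fun i _ => integrable_finsetSum _ fun j _ => h4 i j]
  simp_rw [fun i => integral_finsetSum Finset.univ fun j (_ : j ∈ Finset.univ) => h4 i j,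
    integral_dirCross_four, integral_dirCross_two]
  have h10 := hQ (EuclideanSpace.single 1 1) (EuclideanSpace.single 0 1)
  have h20 := hQ (EuclideanSpace.single 2 1) (EuclideanSpace.single 0 1)
  have h21 := hQ (EuclideanSpace.single 2 1) (EuclideanSpace.single 1 1)
  simp only [Fin.sum_univ_three, inner_eq_coords, medianShift, traceBilin, h10, h20, h21]
  simp [h10, h20, h21]
  ring

theorem measurable_halfSpaceDiff {w : E3 → E3} (hw : Measurable w) (n : E3) :
    Measurable (halfSpaceDiff w n) := by
  have h : Measurable fun p : E3 × E3 => Real.sign ⟪p.1, w p.2 - n⟫ :=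
    measurable_sign.comp (measurable_fst.inner ((hw.comp measurable_snd).sub_const n))
  exact (h.stronglyMeasurable.integral_prod_right' (ν := ballMeasure E3)).measurable

theorem abs_halfSpaceDiff_le (w : E3 → E3) (n ν : E3) :
    |halfSpaceDiff w n ν| ≤ (ballMeasure E3).real Set.univ := by
  have h := norm_integral_le_of_norm_le_const (μ := ballMeasure E3)
    (f := fun c => Real.sign ⟪ν, w c - n⟫) (C := 1) (ae_of_all _ fun c => abs_sign_le _)
  rwa [one_mul] at h

/-- One third of the negative slope at `n`, in direction `e`, of the total tetrahedron volume. -/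
def descentRate (w : E3 → E3) (n e : E3) : ℝ :=
  ∫ p, ⟪cross (w p.1 - n) (w p.2 - n), e⟫ *
    halfSpaceDiff w n (cross (w p.1 - n) (w p.2 - n)) ∂ballPair

theorem measurable_cross_image {w : E3 → E3} (hw : Measurable w) (n : E3) :
    Measurable fun p : E3 × E3 => cross (w p.1 - n) (w p.2 - n) :=
  continuous_cross.measurable.comp (((hw.comp measurable_fst).sub_const n).prodMk
    ((hw.comp measurable_snd).sub_const n))

/-! ### Bounds for the half-space coefficient -/

section Bounds

variable (Q : E3 →L[ℝ] E3 →L[ℝ] E3) {K : ℝ} {k : E3}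

theorem abs_halfSpaceCoeff_le (hk : ‖k‖ ≤ K) {n : E3} (hn : ‖n‖ ≤ 1) :
    |halfSpaceCoeff Q k n| ≤ ‖traceBilin Q‖ + ‖Q‖ + K := by
  have hq : ‖Q n n‖ ≤ ‖Q‖ := by
    refine (Q.le_opNorm₂ _ _).trans ?_
    rw [mul_assoc]
    exact mul_le_of_le_one_right Q.opNorm_nonneg (mul_le_one₀ hn (norm_nonneg _) hn)
  have h1 : |⟪n, traceBilin Q - Q n n⟫| ≤ ‖traceBilin Q‖ + ‖Q‖ :=
    (abs_real_inner_le_norm _ _).trans ((mul_le_of_le_one_left (norm_nonneg _) hn).trans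
      ((norm_sub_le _ _).trans (by gcongr)))
  have h2 : |⟪n, k⟫| ≤ K := (abs_real_inner_le_norm _ _).trans
    ((mul_le_of_le_one_left (norm_nonneg _) hn).trans hk)
  have h3 : 0 ≤ ‖traceBilin Q‖ + ‖Q‖ := by positivity
  rw [halfSpaceCoeff, abs_le]
  rw [abs_le] at h1 h2
  constructor <;> linarith [h1.1, h1.2, h2.1, h2.2]

theorem abs_halfSpaceCoeff_sub_le (hk : ‖k‖ ≤ K) {n n' : E3} (hn : ‖n‖ ≤ 1) (hn' : ‖n'‖ ≤ 1) :
    |halfSpaceCoeff Q k n' - halfSpaceCoeff Q k n|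
      ≤ (‖traceBilin Q‖ + ‖Q‖ + K) * ‖n' - n‖ := by
  have hq : ‖Q n' n'‖ ≤ ‖Q‖ := by
    refine (Q.le_opNorm₂ _ _).trans ?_
    rw [mul_assoc]
    exact mul_le_of_le_one_right Q.opNorm_nonneg (mul_le_one₀ hn' (norm_nonneg _) hn')
  have he : halfSpaceCoeff Q k n' - halfSpaceCoeff Q k n
      = 1 / 8 * (⟪n' - n, traceBilin Q⟫ - ⟪n' - n, Q n' n'⟫ - ⟪n, Q n' n' - Q n n⟫)
        - ⟪n' - n, k⟫ := by
    simp only [halfSpaceCoeff, inner_sub_left, inner_sub_right]; ring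
  have h1 := abs_real_inner_le_norm (n' - n) (traceBilin Q)
  have h2 : |⟪n' - n, Q n' n'⟫| ≤ ‖n' - n‖ * ‖Q‖ := (abs_real_inner_le_norm _ _).trans (by gcongr)
  have h3 : |⟪n, Q n' n' - Q n n⟫| ≤ 2 * ‖Q‖ * ‖n' - n‖ := (abs_real_inner_le_norm _ _).trans
    ((mul_le_of_le_one_left (norm_nonneg _) hn).trans (norm_bilin_sub_le Q hn' hn))
  have h4 : |⟪n' - n, k⟫| ≤ ‖n' - n‖ * K := (abs_real_inner_le_norm _ _).trans (by gcongr)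
  have h5 : 0 ≤ ‖n' - n‖ * ‖traceBilin Q‖ := by positivity
  have h6 : 0 ≤ ‖n' - n‖ * ‖Q‖ := by positivity
  rw [he, abs_le]
  rw [abs_le] at h1 h2 h3 h4
  constructor <;> linarith [h1.1, h1.2, h2.1, h2.2, h3.1, h3.2, h4.1, h4.2]

/-- The factor linear in the vector cancels the singularity of `direction` at 0, so the product is
Lipschitz everywhere. The constant 3 is 1 from the linear factor plus 2 from the direction. -/
theorem abs_inner_mul_halfSpaceCoeff_sub_le (hk : ‖k‖ ≤ K) {e : E3} (he : ‖e‖ ≤ 1) (x y : E3) :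
    |⟪y, e⟫ * halfSpaceCoeff Q k (direction y) - ⟪x, e⟫ * halfSpaceCoeff Q k (direction x)|
      ≤ 3 * (‖traceBilin Q‖ + ‖Q‖ + K) * ‖y - x‖ := by
  set P := ‖traceBilin Q‖ + ‖Q‖ + K
  have hP : 0 ≤ P := (abs_nonneg _).trans (abs_halfSpaceCoeff_le Q hk (n := 0) (by simp))
  have h1 : |⟪y - x, e⟫ * halfSpaceCoeff Q k (direction y)| ≤ ‖y - x‖ * P := by
    rw [abs_mul]
    exact mul_le_mul ((abs_real_inner_le_norm _ _).trans
      (mul_le_of_le_one_right (norm_nonneg _) he))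
      (abs_halfSpaceCoeff_le Q hk (norm_direction_le y)) (abs_nonneg _) (norm_nonneg _)
  have h2 : |⟪x, e⟫ * (halfSpaceCoeff Q k (direction y) - halfSpaceCoeff Q k (direction x))|
      ≤ ‖x‖ * (P * ‖direction y - direction x‖) := by
    rw [abs_mul]
    exact mul_le_mul ((abs_real_inner_le_norm _ _).trans
      (mul_le_of_le_one_right (norm_nonneg _) he))
      (abs_halfSpaceCoeff_sub_le Q hk (norm_direction_le x) (norm_direction_le y))
      (abs_nonneg _) (norm_nonneg _)
  have h3 := mul_le_mul_of_nonneg_left (norm_mul_norm_direction_sub_le x y) hP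
  have e1 : ⟪y, e⟫ * halfSpaceCoeff Q k (direction y) - ⟪x, e⟫ * halfSpaceCoeff Q k (direction x)
      = ⟪y - x, e⟫ * halfSpaceCoeff Q k (direction y)
        + ⟪x, e⟫ * (halfSpaceCoeff Q k (direction y) - halfSpaceCoeff Q k (direction x)) := by
    rw [inner_sub_left]; ring
  rw [e1]
  refine (abs_add_le _ _).trans ?_
  linarith

end Bounds

theorem ApproxQuadratic.norm_sub_le {Q : E3 →L[ℝ] E3 →L[ℝ] E3} {η ρ : ℝ} {w : E3 → E3}
    (h : ApproxQuadratic Q η ρ w) (hη1 : η ≤ 1) (hρ : 0 < ρ) {K : ℝ} {k : E3} (hk : ‖k‖ ≤ K)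
    {y : E3} (hy : ‖y‖ ≤ 1) : ‖w y - ρ • k - y‖ ≤ ρ * (‖Q‖ + K + 1) := by
  have hq : ‖Q y y‖ ≤ ‖Q‖ := by
    refine (Q.le_opNorm₂ _ _).trans ?_
    rw [mul_assoc]
    exact mul_le_of_le_one_right Q.opNorm_nonneg (mul_le_one₀ hy (norm_nonneg _) hy)
  have e : w y - ρ • k - y = (w y - (y + (ρ / 2) • Q y y)) + ((ρ / 2) • Q y y - ρ • k) := by abel
  have h1 : ‖(ρ / 2) • Q y y‖ ≤ ρ * ‖Q‖ := by
    rw [norm_smul, Real.norm_of_nonneg (by positivity)]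
    have := mul_le_mul_of_nonneg_left hq (by positivity : 0 ≤ ρ / 2)
    have := mul_nonneg hρ.le Q.opNorm_nonneg
    linarith
  have h2 : ‖ρ • k‖ ≤ ρ * K := by
    rw [norm_smul, Real.norm_of_nonneg hρ.le]; gcongr
  have h3 := h y hy
  rw [e]
  refine (norm_add_le _ _).trans ((add_le_add h3 ((_root_.norm_sub_le _ _).trans
    (add_le_add h1 h2))).trans ?_)
  nlinarith

/-- Two replacements are made: the half-space difference by its first-order term, and the cross
product of the displaced points by that of the original ones. The second changes a quantity already
carrying a factor `ρ` by `O(ρ)`, so it costs only `ρ ^ 2`. -/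
theorem exists_abs_descentRate_sub_le {Q : E3 →L[ℝ] E3 →L[ℝ] E3} (hQs : ∀ x y, Q x y = Q y x)
    {K : ℝ} (hK : 0 ≤ K) :
    ∃ M : ℝ, 0 ≤ M ∧ ∀ (w : E3 → E3) (η ρ : ℝ) (k e : E3), Measurable w → 0 ≤ η → η ≤ 1 → 0 < ρ →
      ρ ≤ 1 → ApproxQuadratic Q η ρ w → ‖k‖ ≤ K → ‖e‖ ≤ 1 →
      |descentRate w (ρ • k) e - 2 * ρ * (discArea * (meanArea / 3 * ⟪medianShift Q - k, e⟫))|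
        ≤ M * (ρ * (η + ρ)) := by
  obtain ⟨M, hM0, hM⟩ := exists_abs_halfSpaceDiff_sub_le Q hK
  set C := ‖Q‖ + K + 1 with hC
  have hC0 : 0 ≤ C := by positivity
  set P := ‖traceBilin Q‖ + ‖Q‖ + K with hP
  have hP0 : 0 ≤ P := by positivity
  have hd := discArea_pos.le
  refine ⟨((1 + C) * (1 + C) * M + 2 * discArea * (3 * P * (C * (1 + C) + C)))
    * ballPair.real Set.univ, by positivity, ?_⟩
  intro w η ρ k e hw hη hη1 hρ hρ1 hQ hk he
  rw [← integral_inner_cross_mul_halfSpaceCoeff hQs, descentRate, ← integral_const_mul,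
    ← integral_const_mul]
  have hbase : ∀ᵐ p ∂ballPair,
      ‖cross (w p.1 - ρ • k) (w p.2 - ρ • k)‖ ≤ (1 + C) * (1 + C) ∧
      ‖cross (w p.1 - ρ • k) (w p.2 - ρ • k) - cross p.1 p.2‖ ≤ ρ * (C * (1 + C) + C) := by
    filter_upwards [ae_ballPair_norm_le] with p hp
    have h1 := hQ.norm_sub_le hη1 hρ hk hp.1
    have h2 := hQ.norm_sub_le hη1 hρ hk hp.2
    rw [← hC] at h1 h2
    have hle : ∀ y : E3, ‖y‖ ≤ 1 → ‖w y - ρ • k‖ ≤ 1 + C := by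
      intro y hy
      have h := hQ.norm_sub_le hη1 hρ hk hy
      rw [← hC] at h
      have := norm_le_norm_add_norm_sub' (w y - ρ • k) y
      nlinarith
    constructor
    · refine (norm_cross_le _ _).trans ?_
      gcongr
      · exact hle _ hp.1
      · exact hle _ hp.2
    · refine (norm_cross_sub_cross_le _ _ _ _).trans ?_
      calc _ ≤ ρ * C * (1 + C) + 1 * (ρ * C) := by
            gcongr
            · exact hle _ hp.2
            · exact hp.1
        _ = ρ * (C * (1 + C) + C) := by ring
  have hmc := measurable_cross_image hw (ρ • k)
  have hI1 : Integrable (fun p => ⟪cross (w p.1 - ρ • k) (w p.2 - ρ • k), e⟫ *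
      halfSpaceDiff w (ρ • k) (cross (w p.1 - ρ • k) (w p.2 - ρ • k))) ballPair := by
    refine Integrable.of_bound ((hmc.inner_const).mul
      ((measurable_halfSpaceDiff hw _).comp hmc)).aestronglyMeasurable
      ((1 + C) * (1 + C) * (ballMeasure E3).real Set.univ) ?_
    filter_upwards [hbase] with p hp
    rw [norm_mul]
    exact mul_le_mul ((norm_inner_le_norm _ _).trans ((mul_le_of_le_one_right
      (norm_nonneg _) he).trans hp.1)) (abs_halfSpaceDiff_le _ _ _) (norm_nonneg _) (by positivity)
  have hI2 : Integrable (fun p => ⟪cross p.1 p.2, e⟫ * halfSpaceCoeff Q k (dirCross p))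
      ballPair := by
    have hcont : Continuous (halfSpaceCoeff Q k) := by unfold halfSpaceCoeff; fun_prop
    refine Integrable.of_bound ((continuous_cross.measurable.inner_const).mul
      (hcont.measurable.comp measurable_dirCross)).aestronglyMeasurable P ?_
    filter_upwards [ae_norm_cross_le] with p hp
    rw [norm_mul, ← one_mul P]
    exact mul_le_mul ((norm_inner_le_norm _ _).trans (mul_le_one₀ hp (norm_nonneg _) he))
      (abs_halfSpaceCoeff_le Q hk (norm_direction_le _)) (norm_nonneg _) zero_le_one
  rw [← integral_sub hI1 ((hI2.const_mul _).const_mul _), ← Real.norm_eq_abs]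
  refine LE.le.trans (b := ((1 + C) * (1 + C) * M
    + 2 * discArea * (3 * P * (C * (1 + C) + C))) * (ρ * (η + ρ)) * ballPair.real Set.univ)
    (norm_integral_le_of_norm_le_const ?_) (le_of_eq (by ring))
  filter_upwards [hbase] with p hp
  set ν := cross p.1 p.2 with hν
  set ν' := cross (w p.1 - ρ • k) (w p.2 - ρ • k) with hν'
  have h1 := hM w η ρ k ν' hw hη hη1 hρ hρ1 hQ hk
  have h2 := abs_inner_mul_halfSpaceCoeff_sub_le Q hk he ν ν'
  rw [← hP] at h2
  have h3 : |⟪ν', e⟫| ≤ (1 + C) * (1 + C) := (abs_real_inner_le_norm _ _).trans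
    ((mul_le_of_le_one_right (norm_nonneg _) he).trans hp.1)
  have heq : ⟪ν', e⟫ * halfSpaceDiff w (ρ • k) ν'
      - 2 * ρ * (discArea * (⟪ν, e⟫ * halfSpaceCoeff Q k (dirCross p)))
      = ⟪ν', e⟫ * (halfSpaceDiff w (ρ • k) ν'
          - 2 * ρ * (discArea * halfSpaceCoeff Q k (direction ν')))
        + 2 * ρ * discArea * (⟪ν', e⟫ * halfSpaceCoeff Q k (direction ν')
          - ⟪ν, e⟫ * halfSpaceCoeff Q k (direction ν)) := by
    rw [dirCross]; ring
  rw [heq, Real.norm_eq_abs]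
  calc _ ≤ (1 + C) * (1 + C) * (M * (ρ * (η + ρ)))
        + 2 * ρ * discArea * (3 * P * (ρ * (C * (1 + C) + C))) := by
        refine (abs_add_le _ _).trans (add_le_add ?_ ?_)
        · rw [abs_mul]; gcongr
        · rw [abs_mul, abs_of_nonneg (by positivity : 0 ≤ 2 * ρ * discArea)]
          gcongr
          exact h2.trans (by gcongr; exact hp.2)
    _ = (1 + C) * (1 + C) * M * (ρ * (η + ρ))
        + 2 * discArea * (3 * P * (C * (1 + C) + C)) * (ρ * ρ) := by ring
    _ ≤ (1 + C) * (1 + C) * M * (ρ * (η + ρ))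
        + 2 * discArea * (3 * P * (C * (1 + C) + C)) * (ρ * (η + ρ)) := by
        gcongr
        linarith
    _ = _ := by ring

theorem meanArea_pos : 0 < meanArea := by
  have hc : Continuous fun p : E3 × E3 => ‖cross p.1 p.2‖ := continuous_cross.norm
  have hi : Integrable (fun p : E3 × E3 => ‖cross p.1 p.2‖) ballPair := by
    have := integrable_norm_cross_mul (f := fun _ => 1) measurable_const (C := 1) (by simp)
    simpa using this
  rw [meanArea, integral_pos_iff_support_of_nonneg (fun p => norm_nonneg _) hi]
  let U : Set (E3 × E3) := Function.support (fun p : E3 × E3 => ‖cross p.1 p.2‖) ∩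
    (Metric.ball (0 : E3) 1 ×ˢ Metric.ball (0 : E3) 1)
  have hUo : IsOpen U := (hc.isOpen_support).inter (Metric.isOpen_ball.prod Metric.isOpen_ball)
  have hUn : U.Nonempty := by
    refine ⟨((1 / 2 : ℝ) • EuclideanSpace.single 0 1, (1 / 2 : ℝ) • EuclideanSpace.single 1 1),
      ?_, ?_, ?_⟩
    · rw [Function.mem_support, norm_ne_zero_iff]
      intro h
      have h2 := congrArg (fun x : E3 => x 2) h
      simp at h2
    · simp [norm_smul]; norm_num
    · simp [norm_smul]; norm_num
  have hpos : 0 < ((volume : Measure E3).prod (volume : Measure E3)) U := hUo.measure_pos _ hUn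
  refine lt_of_lt_of_le ?_ (measure_mono (Set.inter_subset_left : U ⊆ _))
  rw [ballPair, Measure.prod_restrict, Measure.restrict_apply hUo.measurableSet,
    Set.inter_eq_left.2]
  · exact hpos
  · exact Set.inter_subset_right.trans
      (Set.prod_mono Metric.ball_subset_closedBall Metric.ball_subset_closedBall)

/-! ### The total volume and its subgradients -/

/-- Six times the signed volume of the tetrahedron with vertices `n` and the images of three
points under `w`. -/
def signedVolume (w : E3 → E3) (n : E3) (p : (E3 × E3) × E3) : ℝ :=
  ⟪cross (w p.1.1 - n) (w p.1.2 - n), w p.2 - n⟫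

/-- Six times the total volume of the tetrahedra formed by `n` and the images of three points of
the unit ball under `w`. -/
def volumeSum (w : E3 → E3) (n : E3) : ℝ :=
  ∫ a, ∫ b, ∫ c, |signedVolume w n ((a, b), c)| ∂ballMeasure E3 ∂ballMeasure E3 ∂ballMeasure E3

section VolumeSum

variable {w : E3 → E3} {C : ℝ}

theorem measurable_signedVolume (hw : Measurable w) (n : E3) : Measurable (signedVolume w n) :=
  ((measurable_cross_image hw n).comp measurable_fst).inner
    ((hw.comp measurable_snd).sub_const n)

theorem norm_sub_le_of_bound (hC : ∀ y, ‖w y‖ ≤ C) (n y : E3) : ‖w y - n‖ ≤ C + ‖n‖ :=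
  (norm_sub_le _ _).trans (by gcongr; exact hC y)

theorem norm_cross_image_le (hC : ∀ y, ‖w y‖ ≤ C) (n a b : E3) :
    ‖cross (w a - n) (w b - n)‖ ≤ (C + ‖n‖) ^ 2 := by
  rw [sq]
  exact (norm_cross_le _ _).trans (mul_le_mul (norm_sub_le_of_bound hC n a)
    (norm_sub_le_of_bound hC n b) (norm_nonneg _)
    ((norm_nonneg _).trans (norm_sub_le_of_bound hC n a)))

theorem abs_signedVolume_le (hC : ∀ y, ‖w y‖ ≤ C) (n : E3) (p : (E3 × E3) × E3) :
    |signedVolume w n p| ≤ (C + ‖n‖) ^ 3 := by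
  rw [pow_succ]
  exact (abs_real_inner_le_norm _ _).trans (mul_le_mul (norm_cross_image_le hC n _ _)
    (norm_sub_le_of_bound hC n _) (norm_nonneg _) (sq_nonneg _))

theorem integrable_abs_signedVolume (hw : Measurable w) (hC : ∀ y, ‖w y‖ ≤ C) (n : E3) :
    Integrable (fun p => |signedVolume w n p|) (ballPair.prod (ballMeasure E3)) :=
  Integrable.of_bound (measurable_signedVolume hw n).abs.aestronglyMeasurable ((C + ‖n‖) ^ 3)
    (ae_of_all _ fun p => by rw [Real.norm_eq_abs, abs_abs]; exact abs_signedVolume_le hC n p)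

theorem volumeSum_eq (hw : Measurable w) (hC : ∀ y, ‖w y‖ ≤ C) (n : E3) :
    volumeSum w n = ∫ p, |signedVolume w n p| ∂ballPair.prod (ballMeasure E3) := by
  have hi := integrable_abs_signedVolume hw hC n
  rw [integral_prod _ hi, integral_prod _ hi.integral_prod_left, volumeSum]

theorem continuous_volumeSum (hw : Measurable w) (hC : ∀ y, ‖w y‖ ≤ C) :
    Continuous (volumeSum w) := by
  have hC0 : 0 ≤ C := (norm_nonneg _).trans (hC 0)
  simp_rw [funext (volumeSum_eq hw hC)]
  rw [continuous_iff_continuousAt]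
  intro n₀
  refine continuousAt_of_dominated (bound := fun _ => (C + (‖n₀‖ + 1)) ^ 3)
    (Eventually.of_forall fun n => (measurable_signedVolume hw n).abs.aestronglyMeasurable)
    ?_ (integrable_const _) ?_
  · filter_upwards [Metric.ball_mem_nhds n₀ one_pos] with n hn
    refine ae_of_all _ fun p => ?_
    rw [Real.norm_eq_abs, abs_abs]
    refine (abs_signedVolume_le hC n p).trans ?_
    have h1 : ‖n‖ ≤ ‖n₀‖ + 1 := by
      have h2 := norm_le_norm_add_norm_sub' n n₀
      rw [mem_ball_iff_norm] at hn
      linarith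
    gcongr
  · refine ae_of_all _ fun p => Continuous.continuousAt ?_
    have h : Continuous fun n : E3 => cross (w p.1.1 - n) (w p.1.2 - n) :=
      continuous_cross.comp ((continuous_const.sub continuous_id).prodMk
        (continuous_const.sub continuous_id))
    exact (h.inner (continuous_const.sub continuous_id)).abs

theorem signedVolume_cyclic (n : E3) (p : (E3 × E3) × E3) :
    signedVolume w n ((p.1.2, p.2), p.1.1) = signedVolume w n p := by
  simp only [signedVolume, inner_eq_coords, cross_apply_zero, cross_apply_one, cross_apply_two]
  ring

/-- The triple product is affine in the common vertex: contributions of higher degree in `n' - n`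
repeat a vector and vanish. This is the source of convexity. -/
theorem signedVolume_sub (n n' : E3) (p : (E3 × E3) × E3) :
    signedVolume w n' p - signedVolume w n p =
      -(⟪cross (w p.1.1 - n) (w p.1.2 - n), n' - n⟫ + ⟪cross (w p.1.2 - n) (w p.2 - n), n' - n⟫
        + ⟪cross (w p.2 - n) (w p.1.1 - n), n' - n⟫) := by
  simp only [signedVolume, inner_eq_coords, cross_apply_zero, cross_apply_one, cross_apply_two,
    PiLp.sub_apply]
  ring

theorem integral_cyclic (F : (E3 × E3) × E3 → ℝ) :
    ∫ p, F ((p.1.2, p.2), p.1.1) ∂ballPair.prod (ballMeasure E3)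
      = ∫ p, F p ∂ballPair.prod (ballMeasure E3) := by
  have h : MeasurePreserving
      (MeasurableEquiv.prodAssoc.trans MeasurableEquiv.prodComm : (E3 × E3) × E3 ≃ᵐ (E3 × E3) × E3)
      (ballPair.prod (ballMeasure E3)) (ballPair.prod (ballMeasure E3)) :=
    Measure.measurePreserving_swap.comp (measurePreserving_prodAssoc _ _ _)
  exact h.integral_comp' F

theorem integrable_sign_mul_inner_cross (hw : Measurable w) (hC : ∀ y, ‖w y‖ ≤ C) (n e : E3) :
    Integrable (fun p : (E3 × E3) × E3 => Real.sign (signedVolume w n p) *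
      ⟪cross (w p.1.1 - n) (w p.1.2 - n), e⟫) (ballPair.prod (ballMeasure E3)) := by
  refine Integrable.of_bound ((measurable_sign.comp (measurable_signedVolume hw n)).mul
    (((measurable_cross_image hw n).comp measurable_fst).inner_const)).aestronglyMeasurable
    ((C + ‖n‖) ^ 2 * ‖e‖) (ae_of_all _ fun p => ?_)
  rw [norm_mul, ← one_mul ((C + ‖n‖) ^ 2 * ‖e‖)]
  exact mul_le_mul (abs_sign_le _) ((norm_inner_le_norm _ _).trans (by
    gcongr; exact norm_cross_image_le hC n _ _)) (norm_nonneg _) zero_le_one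

/-- By Fubini: with two points fixed, the sign of the volume tells on which side of their plane
through `n` the third point lies. -/
theorem descentRate_eq (hw : Measurable w) (hC : ∀ y, ‖w y‖ ≤ C) (n e : E3) :
    descentRate w n e = ∫ p : (E3 × E3) × E3, Real.sign (signedVolume w n p) *
      ⟪cross (w p.1.1 - n) (w p.1.2 - n), e⟫ ∂ballPair.prod (ballMeasure E3) := by
  rw [integral_prod _ (integrable_sign_mul_inner_cross hw hC n e), descentRate]
  congr 1; funext p
  rw [mul_comm, halfSpaceDiff, ← integral_mul_const]
  rfl

/-- The subgradient inequality for the total volume. -/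
theorem volumeSum_sub_ge (hw : Measurable w) (hC : ∀ y, ‖w y‖ ≤ C) (n n' : E3) :
    volumeSum w n - 3 * descentRate w n (n' - n) ≤ volumeSum w n' := by
  have hI := integrable_sign_mul_inner_cross hw hC n (n' - n)
  have hcyc : ∀ {F : (E3 × E3) × E3 → ℝ}, Integrable F (ballPair.prod (ballMeasure E3)) →
      Integrable (fun p => F ((p.1.2, p.2), p.1.1)) (ballPair.prod (ballMeasure E3)) := by
    intro F hF
    exact (Measure.measurePreserving_swap.comp
      (measurePreserving_prodAssoc (ballMeasure E3) (ballMeasure E3)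
        (ballMeasure E3))).integrable_comp_of_integrable hF
  -- The slope has one cross-product term for each pair of points. Cyclic permutations preserve both
  -- the signed volume and the product measure, so the three terms integrate to the same value,
  -- whence the factor 3.
  let F : (E3 × E3) × E3 → ℝ := fun p => Real.sign (signedVolume w n p) *
    ⟪cross (w p.1.1 - n) (w p.1.2 - n), n' - n⟫
  have h1 : ∫ p, F ((p.1.2, p.2), p.1.1) ∂ballPair.prod (ballMeasure E3)
      = ∫ p, F p ∂ballPair.prod (ballMeasure E3) := integral_cyclic F
  have h2 : ∫ p, F ((p.2, p.1.1), p.1.2) ∂ballPair.prod (ballMeasure E3)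
      = ∫ p, F p ∂ballPair.prod (ballMeasure E3) := by
    rw [← h1]
    exact integral_cyclic fun p => F ((p.1.2, p.2), p.1.1)
  have i1 := hcyc hI
  have i2 := hcyc i1
  have hle : ∫ p, -(F p + F ((p.1.2, p.2), p.1.1) + F ((p.2, p.1.1), p.1.2))
      ∂ballPair.prod (ballMeasure E3)
      ≤ ∫ p, (|signedVolume w n' p| - |signedVolume w n p|) ∂ballPair.prod (ballMeasure E3) := by
    refine integral_mono ((hI.add i1).add i2).neg
      ((integrable_abs_signedVolume hw hC n').sub (integrable_abs_signedVolume hw hC n)) ?_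
    intro p
    refine le_trans (le_of_eq ?_) (sign_mul_sub_le _ _)
    have e1 := signedVolume_cyclic (w := w) n p
    have e2 := signedVolume_cyclic (w := w) n ((p.1.2, p.2), p.1.1)
    simp only at e2
    rw [e1] at e2
    simp only [F, e1, e2, signedVolume_sub]
    ring
  rw [integral_neg, integral_sub (integrable_abs_signedVolume hw hC n')
    (integrable_abs_signedVolume hw hC n), ← volumeSum_eq hw hC, ← volumeSum_eq hw hC] at hle
  have hadd : ∫ p, (F p + F ((p.1.2, p.2), p.1.1) + F ((p.2, p.1.1), p.1.2))
      ∂ballPair.prod (ballMeasure E3) = 3 * descentRate w n (n' - n) := by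
    refine (integral_add (hI.add i1) i2).trans ?_
    rw [descentRate_eq hw hC]
    have h3 := integral_add hI i1
    have h4 : ∫ p, (F p + F ((p.1.2, p.2), p.1.1)) ∂ballPair.prod (ballMeasure E3)
      = (∫ p, F p ∂ballPair.prod (ballMeasure E3))
        + ∫ p, F ((p.1.2, p.2), p.1.1) ∂ballPair.prod (ballMeasure E3) := h3
    have h5 : ∀ x y z : ℝ, x = y + z → z = y → x + y = 3 * y := by intros; linarith
    exact (congrArg₂ (· + ·) rfl h2).trans (h5 _ _ _ h4 h1)
  rw [hadd] at hle
  linarith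

theorem descentRate_smul (n e : E3) (t : ℝ) :
    descentRate w n (t • e) = t * descentRate w n e := by
  simp only [descentRate, ← integral_const_mul, inner_smul_right, mul_assoc]

end VolumeSum

/-- If a convex function ascends outwards across a sphere, its minimisers lie inside. -/
theorem exists_minimiser_of_descentRate_neg {w : E3 → E3} (hw : Measurable w) {C : ℝ}
    (hC : ∀ y, ‖w y‖ ≤ C) {c : E3} {r : ℝ} (hr : 0 < r)
    (hneg : ∀ e : E3, ‖e‖ = 1 → descentRate w (c + r • e) e < 0) :
    (∃ n, ∀ n', volumeSum w n ≤ volumeSum w n') ∧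
      ∀ n, (∀ n', volumeSum w n ≤ volumeSum w n') → ‖n - c‖ ≤ r := by
  have hout : ∀ n', r < ‖n' - c‖ → ∃ n, ‖n - c‖ ≤ r ∧ volumeSum w n < volumeSum w n' := by
    intro n' hn'
    have hne : n' - c ≠ 0 := norm_pos_iff.1 (hr.trans hn')
    have he := norm_direction hne
    -- The radial projection to the sphere beats `n'`: the subgradient inequality there is applied
    -- along the outward ray.
    refine ⟨c + r • direction (n' - c), ?_, ?_⟩
    · rw [add_sub_cancel_left, norm_smul, he, mul_one, Real.norm_of_nonneg hr.le]
    · have h := volumeSum_sub_ge hw hC (c + r • direction (n' - c)) n'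
      have hd : n' - (c + r • direction (n' - c)) = (‖n' - c‖ - r) • direction (n' - c) := by
        rw [sub_smul, norm_smul_direction]; abel
      rw [hd, descentRate_smul] at h
      have := mul_neg_of_pos_of_neg (sub_pos.2 hn') (hneg _ he)
      linarith
  constructor
  · obtain ⟨m, hm, hmin⟩ := (isCompact_closedBall c r).exists_isMinOn
      (Metric.nonempty_closedBall.2 hr.le) (continuous_volumeSum hw hC).continuousOn
    refine ⟨m, fun n' => ?_⟩
    rcases le_or_gt ‖n' - c‖ r with h | h
    · exact hmin (mem_closedBall_iff_norm.2 h)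
    · obtain ⟨n, hn, hlt⟩ := hout n' h
      exact (hmin (mem_closedBall_iff_norm.2 hn)).trans hlt.le
  · intro n hn
    by_contra! h
    obtain ⟨n₁, -, hlt⟩ := hout n h
    exact absurd (hn n₁) hlt.not_ge

/-- At the displacement `medianShift Q + δ • e` the leading term is a negative multiple of `ρ * δ`,
while the error is `o(ρ)` uniformly in `e`. -/
theorem eventually_descentRate_neg {Q : E3 →L[ℝ] E3 →L[ℝ] E3} (hQs : ∀ x y, Q x y = Q y x)
    {w : ℝ → E3 → E3} (hw : ∀ᶠ ρ in 𝓝[>] (0 : ℝ), Measurable (w ρ))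
    (hA : ∀ η : ℝ, 0 < η → ∀ᶠ ρ in 𝓝[>] (0 : ℝ), ApproxQuadratic Q η ρ (w ρ))
    {δ : ℝ} (hδ : 0 < δ) :
    ∀ᶠ ρ in 𝓝[>] (0 : ℝ), ∀ e : E3, ‖e‖ = 1 →
      descentRate (w ρ) (ρ • medianShift Q + (ρ * δ) • e) e < 0 := by
  obtain ⟨M, hM0, hM⟩ := exists_abs_descentRate_sub_le hQs (K := ‖medianShift Q‖ + δ)
    (by positivity)
  set c := 2 * (discArea * (meanArea / 3 * δ)) with hc
  have hc0 : 0 < c := by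
    have := discArea_pos
    have := meanArea_pos
    positivity
  -- For `ρ < η` this forces `M * (η + ρ) ≤ M * c / (M + 1) < c`; the `M + 1` also covers `M = 0`.
  set η := min 1 (c / (2 * (M + 1))) with hη
  have hη0 : 0 < η := lt_min one_pos (by positivity)
  have hsmall : ∀ᶠ ρ in 𝓝[>] (0 : ℝ), ρ < η :=
    nhdsWithin_le_nhds (eventually_lt_nhds hη0)
  filter_upwards [hw, hA η hη0, hsmall, self_mem_nhdsWithin] with ρ hwρ hAρ hρη hρ e he
  have hρ0 : 0 < ρ := hρ
  have hη1 : η ≤ 1 := min_le_left _ _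
  have hk : ‖medianShift Q + δ • e‖ ≤ ‖medianShift Q‖ + δ := by
    refine (norm_add_le _ _).trans_eq ?_
    rw [norm_smul, he, mul_one, Real.norm_of_nonneg hδ.le]
  have h := hM (w ρ) η ρ (medianShift Q + δ • e) e hwρ hη0.le hη1 hρ0 (hρη.le.trans hη1) hAρ hk he.le
  have hin : ⟪medianShift Q - (medianShift Q + δ • e), e⟫ = -δ := by
    rw [sub_add_cancel_left, inner_neg_left, inner_smul_left, real_inner_self_eq_norm_sq, he]
    simp
  rw [hin, smul_add, smul_smul] at h
  have h1 := (abs_le.1 h).2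
  have h2 : M * (η + ρ) < c := by
    have h3 : η ≤ c / (2 * (M + 1)) := min_le_right _ _
    have h4 : η + ρ ≤ c / (M + 1) := by
      have : c / (2 * (M + 1)) + c / (2 * (M + 1)) = c / (M + 1) := by field_simp; ring
      linarith
    calc M * (η + ρ) ≤ M * (c / (M + 1)) := by gcongr
      _ = c * (M / (M + 1)) := by ring
      _ < c * 1 := by
          gcongr
          rw [div_lt_one (by positivity)]
          linarith
      _ = c := mul_one c
  have h5 := mul_lt_mul_of_pos_left h2 hρ0
  rw [hc] at h5
  linarith

/-! ### Second-order Taylor expansion -/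

/-- The remainder has derivative `o(‖h‖)` because the first derivative is differentiable at `x`. The
mean value inequality on the ball of radius `ρ` then gives the Peano remainder uniformly in `y`. -/
theorem eventually_taylor_two {E F : Type*} [NormedAddCommGroup E] [NormedSpace ℝ E]
    [NormedAddCommGroup F] [NormedSpace ℝ F] {u : E → F} {x : E} (hu : ContDiffAt ℝ 2 u x)
    {η : ℝ} (hη : 0 < η) :
    ∀ᶠ ρ in 𝓝[>] (0 : ℝ), ∀ y : E, ‖y‖ ≤ 1 →
      ‖u (x + ρ • y) - u x - ρ • fderiv ℝ u x y
        - (ρ ^ 2 / 2) • fderiv ℝ (fderiv ℝ u) x y y‖ ≤ η * ρ ^ 2 := by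
  set T := fderiv ℝ (fderiv ℝ u) x with hT
  have hsymm : ∀ a b, T a b = T b a := fun a b =>
    (hu.isSymmSndFDerivAt (by simp)).eq a b
  have hdiff : ∀ᶠ z in 𝓝 x, DifferentiableAt ℝ u z :=
    (hu.eventually (by simp)).mono fun z hz => hz.differentiableAt (by simp)
  have hT' : HasFDerivAt (fderiv ℝ u) T x :=
    ((hu.fderiv_right (m := 1) (by norm_num)).differentiableAt (by simp)).hasFDerivAt
  have hlo : ∀ᶠ z in 𝓝 x, ‖fderiv ℝ u z - fderiv ℝ u x - T (z - x)‖ ≤ η * ‖z - x‖ :=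
    hT'.isLittleO.def hη
  obtain ⟨r, hr, hball⟩ := Metric.eventually_nhds_iff_ball.1 (hdiff.and hlo)
  filter_upwards [self_mem_nhdsWithin, nhdsWithin_le_nhds (eventually_lt_nhds hr)] with ρ hρ hρr y hy
  have hρ0 : 0 < ρ := hρ
  let G : E → F := fun h => u (x + h) - u x - fderiv ℝ u x h - (1 / 2 : ℝ) • T h h
  have hmem : ∀ h : E, ‖h‖ ≤ ρ → x + h ∈ Metric.ball x r := by
    intro h hh
    rw [mem_ball_iff_norm, add_sub_cancel_left]
    exact hh.trans_lt hρr
  have hG : ∀ h ∈ Metric.closedBall (0 : E) ρ,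
      HasFDerivWithinAt G (fderiv ℝ u (x + h) - fderiv ℝ u x - T h) (Metric.closedBall 0 ρ) h := by
    intro h hh
    have hd := (hball _ (hmem h (by simpa using hh))).1
    have h1 : HasFDerivAt (fun h => u (x + h)) (fderiv ℝ u (x + h)) h := by
      have := hd.hasFDerivAt.comp h ((hasFDerivAt_id h).const_add x)
      simpa [Function.comp_def] using this
    -- Symmetry of the second derivative merges the two terms of the product rule.
    have h2 : HasFDerivAt (fun h => (1 / 2 : ℝ) • T h h) (T h) h := by
      have h3 := (T.hasFDerivAt (x := h)).clm_apply (hasFDerivAt_id h)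
      refine (h3.const_smul (1 / 2 : ℝ)).congr_fderiv ?_
      ext v
      simp only [id_eq, _root_.add_apply, _root_.smul_apply, ContinuousLinearMap.comp_apply,
        ContinuousLinearMap.flip_apply, ContinuousLinearMap.id_apply, hsymm v h]
      rw [← two_smul ℝ, smul_smul]
      norm_num
    exact (((h1.sub_const (u x)).sub (fderiv ℝ u x).hasFDerivAt).sub h2).hasFDerivWithinAt
  have hbound : ∀ h ∈ Metric.closedBall (0 : E) ρ,
      ‖fderiv ℝ u (x + h) - fderiv ℝ u x - T h‖ ≤ η * ρ := by
    intro h hh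
    have hh' : ‖h‖ ≤ ρ := by simpa using hh
    have h1 := (hball _ (hmem h hh')).2
    rw [add_sub_cancel_left] at h1
    exact h1.trans (by gcongr)
  have hyρ : ‖ρ • y‖ ≤ ρ := by
    rw [norm_smul, Real.norm_of_nonneg hρ0.le]
    exact mul_le_of_le_one_right hρ0.le hy
  have key := (convex_closedBall (0 : E) ρ).norm_image_sub_le_of_norm_hasFDerivWithin_le hG hbound
    (Metric.mem_closedBall_self hρ0.le) (y := ρ • y) (by simpa using hyρ)
  have hG0 : G 0 = 0 := by simp [G]
  have hGy : G (ρ • y) = u (x + ρ • y) - u x - ρ • fderiv ℝ u x y - (ρ ^ 2 / 2) • T y y := by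
    simp only [G, map_smul, _root_.smul_apply, smul_smul]
    congr 2
    ring
  rw [hG0, sub_zero, sub_zero, hGy] at key
  refine key.trans ?_
  calc η * ρ * ‖ρ • y‖ ≤ η * ρ * ρ := by gcongr
    _ = η * ρ ^ 2 := by ring

/-! ### Rescaling the filter -/

theorem tetraVolume_eq (m a b c : E3) :
    tetraVolume m a b c = |⟪cross (a - m) (b - m), c - m⟫| / 6 := by
  rw [tetraVolume, inner_cross_eq_det]

theorem continuous_tetraVolume (m : E3) :
    Continuous fun p : (E3 × E3) × E3 => tetraVolume m p.1.1 p.1.2 p.2 := by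
  simp_rw [tetraVolume_eq]
  have h : Continuous fun p : (E3 × E3) × E3 => cross (p.1.1 - m) (p.1.2 - m) :=
    continuous_cross.comp (f := fun p : (E3 × E3) × E3 => (p.1.1 - m, p.1.2 - m)) (by fun_prop)
  exact (h.inner (by fun_prop)).abs.div_const 6

theorem integral_map_triple {F : (E3 × E3) × E3 → ℝ} (hF : StronglyMeasurable F) {g : E3 → E3}
    (hg : Measurable g) {β : Measure E3} [SFinite β] :
    ∫ a, ∫ b, ∫ c, F ((a, b), c) ∂Measure.map g β ∂Measure.map g β ∂Measure.map g β
      = ∫ a, ∫ b, ∫ c, F ((g a, g b), g c) ∂β ∂β ∂β := by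
  have h2 : StronglyMeasurable fun p : E3 × E3 => ∫ c, F (p, c) ∂Measure.map g β :=
    hF.integral_prod_right' (ν := Measure.map g β)
  have h1 : StronglyMeasurable fun a : E3 => ∫ b, ∫ c, F ((a, b), c)
      ∂Measure.map g β ∂Measure.map g β := h2.integral_prod_right' (ν := Measure.map g β)
  rw [integral_map hg.aemeasurable h1.aestronglyMeasurable]
  congr 1; funext a
  have h2a : StronglyMeasurable fun b : E3 => ∫ c, F ((g a, b), c) ∂Measure.map g β :=
    h2.comp_measurable (measurable_prodMk_left (x := g a))
  rw [integral_map hg.aemeasurable h2a.aestronglyMeasurable]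
  congr 1; funext b
  have h3b : StronglyMeasurable fun c : E3 => F ((g a, g b), c) :=
    hF.comp_measurable (measurable_prodMk_left (x := (g a, g b)))
  rw [integral_map hg.aemeasurable h3b.aestronglyMeasurable]

theorem ojaObjective_map {g : E3 → E3} (hg : Measurable g) {β : Measure E3} [SFinite β] (m : E3) :
    ojaObjective (Measure.map g β) m
      = ∫ a, ∫ b, ∫ c, tetraVolume m (g a) (g b) (g c) ∂β ∂β ∂β :=
  integral_map_triple (continuous_tetraVolume m).stronglyMeasurable hg

theorem ojaObjective_smul (c : ENNReal) (μ : Measure E3) (m : E3) :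
    ojaObjective (c • μ) m = c.toReal ^ 3 * ojaObjective μ m := by
  simp only [ojaObjective, integral_smul_measure, smul_eq_mul, integral_const_mul]
  ring

theorem restrict_closedBall_eq_smul_map (x : E3) {ρ : ℝ} (hρ : 0 < ρ) :
    (volume : Measure E3).restrict (Metric.closedBall x ρ)
      = ENNReal.ofReal (ρ ^ 3) • Measure.map (fun y => x + ρ • y) (ballMeasure E3) := by
  have hφ : Measurable fun y : E3 => x + ρ • y := by fun_prop
  have hmap : Measure.map (fun y : E3 => x + ρ • y) volume
      = ENNReal.ofReal (ρ ^ 3)⁻¹ • (volume : Measure E3) := by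
    have h1 : (fun y : E3 => x + ρ • y) = (fun z => x + z) ∘ fun y => ρ • y := rfl
    rw [h1, ← Measure.map_map (by fun_prop) (by fun_prop), Measure.map_addHaar_smul _ hρ.ne',
      Measure.map_smul, map_add_left_eq_self, finrank_euclideanSpace_fin,
      abs_of_pos (by positivity)]
  have hpre : (fun y : E3 => x + ρ • y) ⁻¹' Metric.closedBall x ρ = Metric.closedBall 0 1 := by
    ext y
    rw [Set.mem_preimage, mem_closedBall_iff_norm, add_sub_cancel_left, norm_smul,
      Real.norm_of_nonneg hρ.le, mem_closedBall_zero_iff, mul_le_iff_le_one_right hρ]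
  have h := Measure.restrict_map hφ
    (Metric.isClosed_closedBall (x := x) (ε := ρ)).measurableSet (μ := (volume : Measure E3))
  rw [hpre, hmap, Measure.restrict_smul] at h
  rw [← h, smul_smul, ← ENNReal.ofReal_mul (by positivity), mul_inv_cancel₀ (by positivity),
    ENNReal.ofReal_one, one_smul]

/-- If `g` describes the values of `u` on the ball in the coordinates of the unit ball, the local
value distribution is a multiple of the push-forward under `g` of the uniform distribution. -/
theorem localValues_eq_smul_map {u g : E3 → E3} (hg : Measurable g) {x : E3} {ρ : ℝ} (hρ : 0 < ρ)
    (hug : ∀ y, ‖y‖ ≤ 1 → u (x + ρ • y) = g y) :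
    localValues u x ρ = ENNReal.ofReal (ρ ^ 3) • Measure.map g (ballMeasure E3) := by
  have hψ : Measurable fun z : E3 => ρ⁻¹ • (z - x) := by fun_prop
  have hgψ : Measurable fun z : E3 => g (ρ⁻¹ • (z - x)) := hg.comp hψ
  have hae : u =ᵐ[volume.restrict (Metric.closedBall x ρ)] fun z => g (ρ⁻¹ • (z - x)) := by
    filter_upwards [ae_restrict_mem (Metric.isClosed_closedBall (x := x) (ε := ρ)).measurableSet]
      with z hz
    rw [mem_closedBall_iff_norm] at hz
    rw [← hug, smul_smul, mul_inv_cancel₀ hρ.ne', one_smul, add_sub_cancel]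
    rw [norm_smul, norm_inv, Real.norm_of_nonneg hρ.le, inv_mul_le_iff₀ hρ, mul_one]
    exact hz
  rw [localValues, Measure.map_congr hae, restrict_closedBall_eq_smul_map x hρ, Measure.map_smul,
    Measure.map_map hgψ (by fun_prop)]
  congr 2
  funext y
  simp [smul_smul, inv_mul_cancel₀ hρ.ne']

/-! ### Identification of the right-hand side -/

theorem act_eq (M : Matrix (Fin 3) (Fin 3) ℝ) (v : E3) :
    act M v = Matrix.toEuclideanCLM (n := Fin 3) (𝕜 := ℝ) M v := rfl

theorem act_mul (M N : Matrix (Fin 3) (Fin 3) ℝ) (v : E3) : act (M * N) v = act M (act N v) := by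
  simp [act, Matrix.mulVec_mulVec]

theorem act_one (v : E3) : act 1 v = v := by simp [act]

theorem act_sub_left (M N : Matrix (Fin 3) (Fin 3) ℝ) (v : E3) :
    act (M - N) v = act M v - act N v := by
  simp [act, Matrix.sub_mulVec]

theorem act_smul_left (c : ℝ) (M : Matrix (Fin 3) (Fin 3) ℝ) (v : E3) :
    act (c • M) v = c • act M v := by
  simp [act, Matrix.smul_mulVec]

theorem act_sub (M : Matrix (Fin 3) (Fin 3) ℝ) (v w : E3) : act M (v - w) = act M v - act M w := by
  simp only [act_eq, map_sub]

theorem act_smul (M : Matrix (Fin 3) (Fin 3) ℝ) (c : ℝ) (v : E3) : act M (c • v) = c • act M v := by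
  simp only [act_eq, map_smul]

theorem act_apply (M : Matrix (Fin 3) (Fin 3) ℝ) (v : E3) (i : Fin 3) :
    act M v i = M i 0 * v 0 + M i 1 * v 1 + M i 2 * v 2 := by
  simp [act, Matrix.mulVec, dotProduct, Fin.sum_univ_three]

theorem act_conj {D : Matrix (Fin 3) (Fin 3) ℝ} (hD : D.det ≠ 0)
    (N : Matrix (Fin 3) (Fin 3) ℝ) (v : E3) : act (D * N * D⁻¹) (act D v) = act D (act N v) := by
  rw [← act_mul, ← act_mul, Matrix.mul_assoc, Matrix.nonsing_inv_mul _ (isUnit_iff_ne_zero.2 hD),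
    Matrix.mul_one]

theorem act_inv_act {D : Matrix (Fin 3) (Fin 3) ℝ} (hD : D.det ≠ 0) (v : E3) :
    act D⁻¹ (act D v) = v := by
  rw [← act_mul, Matrix.nonsing_inv_mul _ (isUnit_iff_ne_zero.2 hD), act_one]

theorem act_act_inv {D : Matrix (Fin 3) (Fin 3) ℝ} (hD : D.det ≠ 0) (v : E3) :
    act D (act D⁻¹ v) = v := by
  rw [← act_mul, Matrix.mul_nonsing_inv _ (isUnit_iff_ne_zero.2 hD), act_one]

theorem fderiv_apply_eq_act (u : E3 → E3) (x y : E3) :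
    fderiv ℝ u x y = act (jacobian u x) y := by
  have h : fderiv ℝ u x y = y 0 • fderiv ℝ u x (EuclideanSpace.single 0 1)
      + y 1 • fderiv ℝ u x (EuclideanSpace.single 1 1)
      + y 2 • fderiv ℝ u x (EuclideanSpace.single 2 1) := by
    rw [← map_smul, ← map_smul, ← map_smul, ← map_add, ← map_add, ← sum_smul_single]
  rw [h]
  ext i
  simp only [act_apply, jacobian, pderiv, Matrix.of_apply, PiLp.add_apply, PiLp.smul_apply,
    smul_eq_mul]
  ring

theorem pderiv2_eq {u : E3 → E3} {x : E3} (hu : ContDiffAt ℝ 2 u x) (j k : Fin 3) :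
    pderiv2 j k u x = fderiv ℝ (fderiv ℝ u) x (EuclideanSpace.single k 1)
      (EuclideanSpace.single j 1) := by
  have h : HasFDerivAt (fderiv ℝ u) (fderiv ℝ (fderiv ℝ u) x) x :=
    ((hu.fderiv_right (m := 1) (by norm_num)).differentiableAt (by simp)).hasFDerivAt
  have h2 : HasFDerivAt (fun p => fderiv ℝ u p (EuclideanSpace.single j 1))
      ((fderiv ℝ (fderiv ℝ u) x).flip (EuclideanSpace.single j 1)) x := by
    have := h.clm_apply (hasFDerivAt_const (EuclideanSpace.single j (1 : ℝ) : E3) x)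
    simpa using this
  change fderiv ℝ (fun p => fderiv ℝ u p (EuclideanSpace.single j 1)) x _ = _
  rw [h2.fderiv]
  rfl

/-- The second derivative in the coordinates of the linearised image. -/
def pulledHessian (u : E3 → E3) (x : E3) : E3 →L[ℝ] E3 →L[ℝ] E3 :=
  (ContinuousLinearMap.compL ℝ E3 E3 E3
    (Matrix.toEuclideanCLM (n := Fin 3) (𝕜 := ℝ) (jacobian u x)⁻¹)).comp (fderiv ℝ (fderiv ℝ u) x)

theorem pulledHessian_apply (u : E3 → E3) (x y z : E3) :
    pulledHessian u x y z = act (jacobian u x)⁻¹ (fderiv ℝ (fderiv ℝ u) x y z) := rfl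

theorem pulledHessian_symm {u : E3 → E3} {x : E3} (hu : ContDiffAt ℝ 2 u x) (y z : E3) :
    pulledHessian u x y z = pulledHessian u x z y := by
  rw [pulledHessian_apply, pulledHessian_apply, (hu.isSymmSndFDerivAt (by simp)).eq y z]

/-- Each second partial derivative is `D` applied to an entry of `Q`, so the conjugations by `D` in
the coefficient matrices cancel and `D` factors out of both sides. What remains is a coordinate
identity for `medianShift`. -/
theorem act_medianShift {u : E3 → E3} {x : E3} (hu : ContDiffAt ℝ 2 u x)
    (hD : (jacobian u x).det ≠ 0) :
    act (jacobian u x) (medianShift (pulledHessian u x)) = (1 / 60 : ℝ) • ojaRHS u x := by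
  set D := jacobian u x with hDdef
  set Q := pulledHessian u x with hQ
  have hp : ∀ j k, pderiv2 j k u x
      = act D (Q (EuclideanSpace.single j 1) (EuclideanSpace.single k 1)) := by
    intro j k
    rw [pderiv2_eq hu, hQ, pulledHessian_symm hu, pulledHessian_apply, act_act_inv hD]
  have h10 := pulledHessian_symm hu (EuclideanSpace.single 1 1) (EuclideanSpace.single 0 1)
  have h20 := pulledHessian_symm hu (EuclideanSpace.single 2 1) (EuclideanSpace.single 0 1)
  have h21 := pulledHessian_symm hu (EuclideanSpace.single 2 1) (EuclideanSpace.single 1 1)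
  rw [← hQ] at h10 h20 h21
  rw [ojaRHS, ← hDdef]
  simp only [hp, A₁, A₂, B₁, B₂, B₃, ← act_sub, act_sub_left, act_smul_left, act_conj hD, act_one]
  simp only [act_eq, ← map_add, ← map_sub, ← map_smul]
  simp only [← act_eq]
  congr 1
  ext i
  fin_cases i <;>
    simp [medianShift, traceBilin, act_apply, Fin.sum_univ_three, h10, h20, h21] <;> ring

theorem ojaRHS_eq_of_jacobian_eq_one {u : E3 → E3} {x : E3} (h : jacobian u x = 1) :
    ojaRHS u x = (3 : ℝ) • ojaRHSUnit u x := by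
  rw [ojaRHS, h]
  simp only [A₁, A₂, B₁, B₂, B₃, one_mul, inv_one, mul_one, act_sub_left, act_smul_left, act_one]
  ext i
  fin_cases i <;> simp [ojaRHSUnit, act_apply] <;> ring

/-! ### The main theorem -/

theorem inner_cross_act (D : Matrix (Fin 3) (Fin 3) ℝ) (a b c : E3) :
    ⟪cross (act D a) (act D b), act D c⟫ = D.det * ⟪cross a b, c⟫ := by
  simp only [inner_eq_coords, cross_apply_zero, cross_apply_one, cross_apply_two, act_apply,
    Matrix.det_fin_three]
  ring

theorem tetraVolume_affine (D : Matrix (Fin 3) (Fin 3) ℝ) (x : E3) {ρ : ℝ} (hρ : 0 < ρ)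
    (n a b c : E3) :
    tetraVolume (x + ρ • act D n) (x + ρ • act D a) (x + ρ • act D b) (x + ρ • act D c)
      = ρ ^ 3 * |D.det| / 6 * |⟪cross (a - n) (b - n), c - n⟫| := by
  have h : ∀ y : E3, x + ρ • act D y - (x + ρ • act D n) = act (ρ • D) (y - n) := by
    intro y
    rw [add_sub_add_left_eq_sub, ← smul_sub, ← act_sub, act_smul_left]
  rw [tetraVolume_eq, h, h, h, inner_cross_act, abs_mul, Matrix.det_smul, abs_mul,
    abs_of_pos (by positivity : 0 < ρ ^ Fintype.card (Fin 3)), Fintype.card_fin]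
  ring

theorem ojaObjective_localValues {u w : E3 → E3} (hw : Measurable w) {x : E3}
    {D : Matrix (Fin 3) (Fin 3) ℝ} {ρ : ℝ} (hρ : 0 < ρ)
    (huw : ∀ y, ‖y‖ ≤ 1 → u (x + ρ • y) = u x + ρ • act D (w y)) (n : E3) :
    ojaObjective (localValues u x ρ) (u x + ρ • act D n)
      = (ρ ^ 3) ^ 3 * (ρ ^ 3 * |D.det| / 6) * volumeSum w n := by
  have hg : Measurable fun y => u x + ρ • act D (w y) := by
    simp only [act_eq]
    exact (((ContinuousLinearMap.continuous _).measurable.comp hw).const_smul ρ).const_add _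
  rw [localValues_eq_smul_map hg hρ huw, ojaObjective_smul, ojaObjective_map hg,
    ENNReal.toReal_ofReal (by positivity)]
  simp only [tetraVolume_affine D (u x) hρ, integral_const_mul, volumeSum, signedVolume]
  ring

/-- The image near `x` in rescaled coordinates that make its linearisation the identity. -/
def rescaledImage (u : E3 → E3) (x : E3) (ρ : ℝ) : E3 → E3 :=
  (Metric.closedBall (0 : E3) 1).indicator
    fun y => ρ⁻¹ • act (jacobian u x)⁻¹ (u (x + ρ • y) - u x)

theorem rescaledImage_of_mem (u : E3 → E3) (x : E3) (ρ : ℝ) {y : E3} (hy : ‖y‖ ≤ 1) :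
    rescaledImage u x ρ y = ρ⁻¹ • act (jacobian u x)⁻¹ (u (x + ρ • y) - u x) :=
  Set.indicator_of_mem (by simpa using hy) _

theorem act_rescaledImage {u : E3 → E3} {x : E3} (hD : (jacobian u x).det ≠ 0) {ρ : ℝ} (hρ : 0 < ρ)
    {y : E3} (hy : ‖y‖ ≤ 1) :
    u (x + ρ • y) = u x + ρ • act (jacobian u x) (rescaledImage u x ρ y) := by
  rw [rescaledImage_of_mem u x ρ hy, act_smul, act_act_inv hD, smul_smul, mul_inv_cancel₀ hρ.ne',
    one_smul, add_sub_cancel]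

/-- The image is controlled only near `x`; since `rescaledImage` is cut off outside the unit ball,
continuity of `u` on a small ball suffices. -/
theorem eventually_measurable_rescaledImage {u : E3 → E3} {x : E3} (hu : ContDiffAt ℝ 2 u x) :
    ∀ᶠ ρ in 𝓝[>] (0 : ℝ), Measurable (rescaledImage u x ρ) := by
  have hc : ∀ᶠ z in 𝓝 x, ContinuousAt u z :=
    (hu.eventually (by simp)).mono fun z hz => hz.continuousAt
  obtain ⟨r, hr, hball⟩ := Metric.eventually_nhds_iff_ball.1 hc
  filter_upwards [self_mem_nhdsWithin, nhdsWithin_le_nhds (eventually_lt_nhds hr)] with ρ hρ hρr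
  have hρ0 : 0 < ρ := hρ
  classical
  have hcont : ContinuousOn (fun y => ρ⁻¹ • act (jacobian u x)⁻¹ (u (x + ρ • y) - u x))
      (Metric.closedBall (0 : E3) 1) := by
    intro y hy
    have hmem : x + ρ • y ∈ Metric.ball x r := by
      rw [mem_ball_iff_norm, add_sub_cancel_left, norm_smul, Real.norm_of_nonneg hρ0.le]
      exact (mul_le_of_le_one_right hρ0.le (by simpa using hy)).trans_lt hρr
    have h1 : ContinuousAt (fun y : E3 => u (x + ρ • y)) y :=
      ContinuousAt.comp (f := fun y : E3 => x + ρ • y) (hball _ hmem) (by fun_prop)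
    simp only [act_eq]
    set L := Matrix.toEuclideanCLM (n := Fin 3) (𝕜 := ℝ) (jacobian u x)⁻¹
    have h2 : ContinuousAt (fun y : E3 => L (u (x + ρ • y) - u x)) y :=
      L.continuous.continuousAt.comp (h1.sub continuousAt_const)
    exact (h2.const_smul ρ⁻¹).continuousWithinAt
  have := hcont.measurable_piecewise (continuousOn_const (c := (0 : E3)))
    Metric.isClosed_closedBall.measurableSet
  rw [rescaledImage, ← Set.piecewise_eq_indicator]
  exact this

theorem eventually_approxQuadratic_rescaledImage {u : E3 → E3} {x : E3} (hu : ContDiffAt ℝ 2 u x)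
    (hD : (jacobian u x).det ≠ 0) {η : ℝ} (hη : 0 < η) :
    ∀ᶠ ρ in 𝓝[>] (0 : ℝ), ApproxQuadratic (pulledHessian u x) η ρ (rescaledImage u x ρ) := by
  set L := Matrix.toEuclideanCLM (n := Fin 3) (𝕜 := ℝ) (jacobian u x)⁻¹ with hL
  filter_upwards [self_mem_nhdsWithin,
    -- The tolerance anticipates the loss of a factor `‖L‖` on applying the inverse Jacobian.
    eventually_taylor_two hu (η := η / (‖L‖ + 1)) (by positivity)] with ρ hρ h y hy
  have hρ0 : 0 < ρ := hρ
  have he : rescaledImage u x ρ y - (y + (ρ / 2) • pulledHessian u x y y)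
      = ρ⁻¹ • L (u (x + ρ • y) - u x - ρ • fderiv ℝ u x y
        - (ρ ^ 2 / 2) • fderiv ℝ (fderiv ℝ u) x y y) := by
    have h1 : L (fderiv ℝ u x y) = y := by
      rw [fderiv_apply_eq_act, hL, ← act_eq, act_inv_act hD]
    rw [rescaledImage_of_mem u x ρ hy, pulledHessian_apply, act_eq, act_eq, ← hL]
    simp only [map_sub, map_smul, h1, smul_sub, smul_smul, inv_mul_cancel₀ hρ0.ne', one_smul]
    rw [show ρ⁻¹ * (ρ ^ 2 / 2) = ρ / 2 by field_simp]
    abel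
  rw [he, norm_smul, norm_inv, Real.norm_of_nonneg hρ0.le, inv_mul_le_iff₀ hρ0]
  calc _ ≤ ‖L‖ * (η / (‖L‖ + 1) * ρ ^ 2) := (L.le_opNorm _).trans (by gcongr; exact h y hy)
    _ = ‖L‖ / (‖L‖ + 1) * (η * ρ ^ 2) := by ring
    _ ≤ 1 * (η * ρ ^ 2) := by
        gcongr
        rw [div_le_one (by positivity)]
        linarith
    _ = ρ * (η * ρ) := by ring

theorem ApproxQuadratic.exists_bound {u : E3 → E3} {x : E3} {ρ : ℝ} (hρ : 0 < ρ)
    (h : ApproxQuadratic (pulledHessian u x) 1 ρ (rescaledImage u x ρ)) :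
    ∃ C, ∀ y, ‖rescaledImage u x ρ y‖ ≤ C := by
  refine ⟨1 + ρ * (‖pulledHessian u x‖ + 0 + 1), fun y => ?_⟩
  by_cases hy : ‖y‖ ≤ 1
  · have h1 := h.norm_sub_le le_rfl hρ (k := 0) (K := 0) (by simp) hy
    rw [smul_zero, sub_zero] at h1
    linarith [norm_le_norm_add_norm_sub' (rescaledImage u x ρ y) y]
  · have h0 : rescaledImage u x ρ y = 0 := Set.indicator_of_notMem (by simpa using hy) _
    rw [h0, norm_zero]
    positivity

theorem eventually_filterValue {u : E3 → E3} {x : E3} (hu : ContDiffAt ℝ 2 u x)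
    (hD : (jacobian u x).det ≠ 0) {δ : ℝ} (hδ : 0 < δ) :
    ∀ᶠ ρ in 𝓝[>] (0 : ℝ), (∃ m, IsOjaFilterValue u x ρ m) ∧ ∀ m, IsOjaFilterValue u x ρ m →
      ∃ n : E3, m = u x + ρ • act (jacobian u x) n ∧
        ‖n - ρ • medianShift (pulledHessian u x)‖ ≤ ρ * δ := by
  filter_upwards [self_mem_nhdsWithin, eventually_measurable_rescaledImage hu,
    eventually_approxQuadratic_rescaledImage hu hD one_pos,
    eventually_descentRate_neg (pulledHessian_symm hu) (eventually_measurable_rescaledImage hu)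
      (fun η hη => eventually_approxQuadratic_rescaledImage hu hD hη) hδ] with ρ hρ hw happ hneg
  have hρ0 : 0 < ρ := hρ
  obtain ⟨C, hC⟩ := happ.exists_bound hρ0
  obtain ⟨hex, hall⟩ := exists_minimiser_of_descentRate_neg hw hC (mul_pos hρ0 hδ) hneg
  have hobj := ojaObjective_localValues hw hρ0 (D := jacobian u x)
    (fun y hy => act_rescaledImage hD hρ0 hy)
  have hκ : 0 < (ρ ^ 3) ^ 3 * (ρ ^ 3 * |(jacobian u x).det| / 6) := by
    have := abs_pos.2 hD
    positivity
  -- Invertibility of the Jacobian makes the rescaling onto, so minimality over all `n` and over all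
  -- `m` are equivalent.
  have hsurj : ∀ m : E3, m = u x + ρ • act (jacobian u x)
      (ρ⁻¹ • act (jacobian u x)⁻¹ (m - u x)) := by
    intro m
    rw [act_smul, act_act_inv hD, smul_smul, mul_inv_cancel₀ hρ0.ne', one_smul, add_sub_cancel]
  constructor
  · obtain ⟨n, hn⟩ := hex
    refine ⟨u x + ρ • act (jacobian u x) n, fun m' => ?_⟩
    rw [hsurj m', hobj, hobj]
    exact mul_le_mul_of_nonneg_left (hn _) hκ.le
  · intro m hm
    refine ⟨_, hsurj m, hall _ fun n' => ?_⟩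
    have h := hm (u x + ρ • act (jacobian u x) n')
    rw [hsurj m, hobj, hobj] at h
    exact le_of_mul_le_mul_left h hκ

theorem ojaStepApproximates_ojaRHS {u : E3 → E3} {x : E3} (hu : ContDiffAt ℝ 2 u x)
    (hD : (jacobian u x).det ≠ 0) :
    OjaStepApproximates u x (fun ρ => ρ ^ 2 / 60) (ojaRHS u x) := by
  refine ⟨(eventually_filterValue hu hD one_pos).mono fun ρ h => h.1, fun ε hε => ?_⟩
  set A := Matrix.toEuclideanCLM (n := Fin 3) (𝕜 := ℝ) (jacobian u x) with hA
  filter_upwards [self_mem_nhdsWithin,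
    -- Mapping back costs a factor `ρ * ‖A‖`, so the radius `ρ * δ` becomes an error of at most `ε *
    -- ρ ^ 2 / 60`.
    eventually_filterValue hu hD (δ := ε / 60 / (‖A‖ + 1)) (by positivity)] with ρ hρ h m hm
  have hρ0 : 0 < ρ := hρ
  obtain ⟨n, rfl, hn⟩ := h.2 m hm
  have he : u x + ρ • act (jacobian u x) n - (u x + (ρ ^ 2 / 60) • ojaRHS u x)
      = ρ • A (n - ρ • medianShift (pulledHessian u x)) := by
    rw [map_sub, map_smul, hA, ← act_eq, ← act_eq, act_medianShift hu hD, smul_sub, smul_smul,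
      smul_smul, add_sub_add_left_eq_sub]
    congr 2
    ring
  rw [he, norm_smul, Real.norm_of_nonneg hρ0.le]
  calc ρ * ‖A (n - ρ • medianShift (pulledHessian u x))‖
      ≤ ρ * (‖A‖ * (ρ * (ε / 60 / (‖A‖ + 1)))) := by
        gcongr
        exact (A.le_opNorm _).trans (by gcongr)
    _ = ‖A‖ / (‖A‖ + 1) * (ε * (ρ ^ 2 / 60)) := by ring
    _ ≤ 1 * (ε * (ρ ^ 2 / 60)) := by
        gcongr
        rw [div_le_one (by positivity)]
        linarith
    _ = ε * (ρ ^ 2 / 60) := one_mul _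

theorem OjaStepApproximates.rescale {u : E3 → E3} {x F G : E3} {τ σ : ℝ → ℝ} {c : ℝ} (hc : 0 < c)
    (h : OjaStepApproximates u x τ F) (hτ : ∀ ρ, σ ρ = c * τ ρ) (hF : F = c • G) :
    OjaStepApproximates u x σ G := by
  refine ⟨h.1, fun ε hε => ?_⟩
  filter_upwards [h.2 (ε * c) (by positivity)] with ρ hρ m hm
  have := hρ m hm
  rwa [hF, smul_smul, mul_comm (τ ρ) c, ← hτ, mul_assoc, ← hτ] at this

end OjaMedian

end

theorem mainTheorem2 (Ω : Set OjaMedian.E3) (u : OjaMedian.E3 → OjaMedian.E3)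
    (hu : ContDiffOn ℝ 2 u Ω) (x₀ : OjaMedian.E3) (hx₀ : x₀ ∈ interior Ω) :
    ((OjaMedian.jacobian u x₀).det ≠ 0 →
      OjaMedian.OjaStepApproximates u x₀ (fun ρ => ρ ^ 2 / 60) (OjaMedian.ojaRHS u x₀)) ∧
    (OjaMedian.jacobian u x₀ = 1 →
      OjaMedian.OjaStepApproximates u x₀ (fun ρ => ρ ^ 2 / 20) (OjaMedian.ojaRHSUnit u x₀)) := by
  have hu' : ContDiffAt ℝ 2 u x₀ := hu.contDiffAt (mem_interior_iff_mem_nhds.1 hx₀)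
  refine ⟨fun hD => OjaMedian.ojaStepApproximates_ojaRHS hu' hD, fun h1 => ?_⟩
  have hD : (OjaMedian.jacobian u x₀).det ≠ 0 := by rw [h1, Matrix.det_one]; exact one_ne_zero
  -- For the unit Jacobian the general right-hand side is three times the special one, and the
  -- factor moves into the step size: `3 / 60 = 1 / 20`.
  exact (OjaMedian.ojaStepApproximates_ojaRHS hu' hD).rescale (by norm_num : (0 : ℝ) < 3)
    (fun ρ => by ring) (OjaMedian.ojaRHS_eq_of_jacobian_eq_one h1)
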